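/- Notation. Let $\Delta=\{|z|<1\}$ and let $\Delta^*=\{1<|z|\le\infty\}$ be the open disk at $\infty$. Let $s>0$ be non-integral. $C^s(S^1)$ is the usual Hölder space: with $k=\lfloor s\rfloor$, it consists of the functions $\phi:S^1\to\mathbb C$ for which $\theta\mapsto\phi(e^{i\theta})$ is $k$ times continuously differentiable with $k$-th derivative Hölder continuous of exponent $s-k$. $C^s(S^1,SL(2,\mathbb C))$ is the set of maps $S^1\to SL(2,\mathbb C)$ whose entries are in $C^s(S^1)$. A holomorphic function $f\in H^0(\Delta)$ has $C^s$ boundary values if it extends continuously to $\overline\Delta$ and the extension restricted to $S^1$ is in $C^s(S^1)$. For such $f$ put $f^*(z)=\overline{f(1/\bar z)}$ for $1\le|z|<\infty$ and $f^*(\infty)=\overline{f(0)}$; thus if $f=\sum_{j\ge0} f_jz^j$ in $\Delta$, then $f^*=\sum_{j\ge0}\overline{f_j}z^{-j}$ in $\Delta^*$. For a loop $g$, $g^{-*}(z)=(g(z)^{-1})^*$ is the Hermitian adjoint of the inverse. **Theorem.** Suppose that $g_1\in C^s(S^1,SL(2,\mathbb C))$, where $s>0$ is non-integral. The following are equivalent.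 (I.1) $g_1$ is of the form $$g_1(z)=\begin{pmatrix} a_1(z)&b_1(z)\\ c_1^*(z)&d_1^*(z)\end{pmatrix},\quad z\in S^1,$$ where $a_1,b_1,c_1,d_1\in H^0(\Delta)$ have $C^s$ boundary values, $a_1(0)=d_1^*(\infty)\ne0$, and neither the pair $a_1,b_1$ nor the pair $c_1,d_1$ has a common zero in $\Delta$. (I.3) There is a constant $\mathbf a_1\in\mathbb C\setminus\{0\}$ such that, on $S^1$, $$g_1=\begin{pmatrix}1&0\\ y^*&1\end{pmatrix}\begin{pmatrix}\mathbf a_1&0\\0&\mathbf a_1^{-1}\end{pmatrix}\begin{pmatrix}\alpha_1&\beta_1\\ \gamma_1&\delta_1\end{pmatrix} \quad\text{and}\quad g_1^{-*}=\begin{pmatrix}1&0\\ \mathbf y^*&1\end{pmatrix}\begin{pmatrix}\overline{\mathbf a_1}&0\\0&\overline{\mathbf a_1}^{\,-1}\end{pmatrix}\begin{pmatrix}\alpha_1'&\beta_1'\\ \gamma_1'&\delta_1'\end{pmatrix},$$ where $y,\mathbf y\in H^0(\Delta)$ have $C^s$ boundary values (so that $y^*=\sum_{j\ge0}y_j^*z^{-j}$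 with $y_j^*=\overline{y_j}$, and likewise for $\mathbf y^*$), and the third factors belong to $H^0(\Delta,SL(2,\mathbb C))$, have entries with $C^s$ boundary values, and are unipotent upper triangular at $z=0$. Similarly, suppose that $g_2\in C^s(S^1,SL(2,\mathbb C))$. The following are equivalent. (II.1) $g_2$ is of the form $$g_2(z)=\begin{pmatrix} a_2^*(z)&b_2^*(z)\\ c_2(z)&d_2(z)\end{pmatrix},\quad z\in S^1,$$ where $a_2,b_2,c_2,d_2\in H^0(\Delta)$ have $C^s$ boundary values, $b_2(0)=c_2(0)=0$, $a_2^*(\infty)=d_2(0)\ne0$, and neither the pair $a_2,b_2$ nor the pair $c_2,d_2$ has a common zero in $\Delta$. (II.3) There is a constant $\mathbf a_2\in\mathbb C\setminus\{0\}$ such that, on $S^1$, $$g_2=\begin{pmatrix}1&x^*\\ 0&1\end{pmatrix}\begin{pmatrix}\mathbf a_2&0\\0&\mathbf a_2^{-1}\end{pmatrix}\begin{pmatrix}\alpha_2&\beta_2\\ \gamma_2&\delta_2\end{pmatrix} \quad\text{and}\quad g_2^{-*}=\begin{pmatrix}1&\mathbf x^*\\ 0&1\end{pmatrix}\begin{pmatrix}\overline{\mathbf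 a_2}&0\\0&\overline{\mathbf a_2}^{\,-1}\end{pmatrix}\begin{pmatrix}\alpha_2'&\beta_2'\\ \gamma_2'&\delta_2'\end{pmatrix},$$ where $x,\mathbf x\in H^0(\Delta)$ have $C^s$ boundary values and $x(0)=\mathbf x(0)=0$ (so that $x^*=\sum_{j\ge1}x_j^*z^{-j}$ with $x_j^*=\overline{x_j}$, and likewise for $\mathbf x^*$), and the third factors belong to $H^0(\Delta,SL(2,\mathbb C))$, have entries with $C^s$ boundary values, and are unipotent upper triangular at $z=0$. -/

import Mathlib

open scoped ComplexConjugate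

/-- `φ ∈ C^s(S¹, ℂ)` for `s > 0` not an integer: with `k = ⌊s⌋`, the `2π`-periodic function
`θ ↦ φ (e^{iθ})` is `k` times continuously differentiable and its `k`-th derivative is Hölder
continuous with exponent `s - k ∈ (0, 1)`. -/
def IsCsOnCircle (s : ℝ) (φ : Circle → ℂ) : Prop :=
  ContDiff ℝ (⌊s⌋₊ : ℕ) (fun θ : ℝ => φ (Circle.exp θ)) ∧
    ∃ C : NNReal, HolderWith C (s - (⌊s⌋₊ : ℝ)).toNNReal
      (iteratedDeriv ⌊s⌋₊ (fun θ : ℝ => φ (Circle.exp θ)))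

/-- `g ∈ C^s(S¹, SL(2, ℂ))`: all matrix entries are of class `C^s`. -/
def IsCsLoop (s : ℝ) (g : Circle → Matrix.SpecialLinearGroup (Fin 2) ℂ) : Prop :=
  ∀ i j : Fin 2, IsCsOnCircle s (fun z => (g z).1 i j)

/-- `f ∈ H⁰(Δ)` has `C^s` boundary values: `f` is holomorphic in the open unit disk, continuous
on the closed disk, and its restriction to the unit circle is of class `C^s`. (The values of `f`
outside the closed disk are irrelevant.) -/
def HolomorphicCs (s : ℝ) (f : ℂ → ℂ) : Prop :=
  DiffContOnCl ℂ f (Metric.ball (0 : ℂ) 1) ∧ IsCsOnCircle s (fun z : Circle => f (z : ℂ))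

/-- The reflected function `f^*(z) = conj (f (1 / conj z))`, with `f^*(∞) = conj (f 0)`, on the
Riemann sphere. If `f = ∑ fₙ zⁿ` in the disk `Δ`, then `f^* = ∑ (conj fₙ) z⁻ⁿ` in the disk `Δ^*`
around `∞`. (It is only used on the closure of `Δ^*`, i.e. for `1 ≤ |z| ≤ ∞`.) -/
noncomputable def reflect (f : ℂ → ℂ) : OnePoint ℂ → ℂ :=
  fun p => p.elim (conj (f 0)) (fun z : ℂ => conj (f (conj z)⁻¹))

theorem reflect_infty (f : ℂ → ℂ) : reflect f OnePoint.infty = conj (f 0) := rfl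

theorem reflect_circle (f : ℂ → ℂ) (z : Circle) :
    reflect f ((z : ℂ) : OnePoint ℂ) = conj (f (z : ℂ)) := by
  change conj (f (conj (z : ℂ))⁻¹) = conj (f (z : ℂ))
  rw [← Circle.coe_inv_eq_conj, Circle.coe_inv, inv_inv]

/-- The loop `g^{-*} = (g⁻¹)^*` (pointwise Hermitian adjoint of the inverse), as a matrix valued
function on the circle. -/
noncomputable def invStar (g : Circle → Matrix.SpecialLinearGroup (Fin 2) ℂ) :
    Circle → Matrix (Fin 2) (Fin 2) ℂ :=
  fun z => ((g z)⁻¹).1.conjTranspose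

/-- Two functions have no common zero in the open unit disk. -/
def NoCommonZero (f h : ℂ → ℂ) : Prop :=
  ∀ z ∈ Metric.ball (0 : ℂ) 1, ¬ (f z = 0 ∧ h z = 0)

/-- The right factor `u = (α, β; γ, δ)` of a triangular factorization, with `C^s` boundary values:
`u ∈ H⁰(Δ, SL(2, ℂ))` and `u(0)` is unipotent upper triangular. -/
def IsRightFactor (s : ℝ) (α β γ δ : ℂ → ℂ) : Prop :=
  HolomorphicCs s α ∧ HolomorphicCs s β ∧ HolomorphicCs s γ ∧ HolomorphicCs s δ ∧
    (∀ z ∈ Metric.ball (0 : ℂ) 1, (!![α z, β z; γ z, δ z]).det = 1) ∧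
    α 0 = 1 ∧ γ 0 = 0 ∧ δ 0 = 1

/-- `G = (1, 0; y^*, 1) · diag(t, t⁻¹) · (α, β; γ, δ)` on the circle, where `y^*` is holomorphic in
`Δ^*` (with an arbitrary value at `∞`), all factors have `C^s` boundary values and the third
factor is unipotent upper triangular at `0`. -/
def HasLowerFactorization (s : ℝ) (G : Circle → Matrix (Fin 2) (Fin 2) ℂ) (t : ℂ) : Prop :=
  ∃ y α β γ δ : ℂ → ℂ, HolomorphicCs s y ∧ IsRightFactor s α β γ δ ∧
    ∀ z : Circle, G z =
      !![1, 0; reflect y ((z : ℂ) : OnePoint ℂ), 1] * !![t, 0; 0, t⁻¹] *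
        !![α z, β z; γ z, δ z]

/-- `G = (1, x^*; 0, 1) · diag(t, t⁻¹) · (α, β; γ, δ)` on the circle, where `x^*` is holomorphic in
`Δ^*` and vanishes at `∞`, all factors have `C^s` boundary values and the third factor is unipotent
upper triangular at `0`. -/
def HasUpperFactorization (s : ℝ) (G : Circle → Matrix (Fin 2) (Fin 2) ℂ) (t : ℂ) : Prop :=
  ∃ x α β γ δ : ℂ → ℂ, HolomorphicCs s x ∧ reflect x OnePoint.infty = 0 ∧
    IsRightFactor s α β γ δ ∧
    ∀ z : Circle, G z =
      !![1, reflect x ((z : ℂ) : OnePoint ℂ); 0, 1] * !![t, 0; 0, t⁻¹] *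
        !![α z, β z; γ z, δ z]

/-- Matrix form of the first kind: `g = (a, b; c^*, d^*)`. -/
def MatrixFormOne (s : ℝ) (g : Circle → Matrix.SpecialLinearGroup (Fin 2) ℂ) : Prop :=
  ∃ a b c d : ℂ → ℂ,
    HolomorphicCs s a ∧ HolomorphicCs s b ∧ HolomorphicCs s c ∧ HolomorphicCs s d ∧
    (∀ z : Circle, (g z).1 =
      !![a z, b z;
        reflect c ((z : ℂ) : OnePoint ℂ), reflect d ((z : ℂ) : OnePoint ℂ)]) ∧
    a 0 = reflect d OnePoint.infty ∧ a 0 ≠ 0 ∧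
    NoCommonZero a b ∧ NoCommonZero c d

/-- Triangular factorizations of the first kind, of both `g` and `g^{-*}`, whose diagonal
constants are conjugate to each other. -/
def TriangularOne (s : ℝ) (g : Circle → Matrix.SpecialLinearGroup (Fin 2) ℂ) : Prop :=
  ∃ t : ℂ, t ≠ 0 ∧ HasLowerFactorization s (fun z => (g z).1) t ∧
    HasLowerFactorization s (invStar g) (conj t)

/-- Matrix form of the second kind: `g = (a^*, b^*; c, d)`. -/
def MatrixFormTwo (s : ℝ) (g : Circle → Matrix.SpecialLinearGroup (Fin 2) ℂ) : Prop :=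
  ∃ a b c d : ℂ → ℂ,
    HolomorphicCs s a ∧ HolomorphicCs s b ∧ HolomorphicCs s c ∧ HolomorphicCs s d ∧
    (∀ z : Circle, (g z).1 =
      !![reflect a ((z : ℂ) : OnePoint ℂ), reflect b ((z : ℂ) : OnePoint ℂ);
        c z, d z]) ∧
    b 0 = 0 ∧ c 0 = 0 ∧
    reflect a OnePoint.infty = d 0 ∧ d 0 ≠ 0 ∧
    NoCommonZero a b ∧ NoCommonZero c d

/-- Triangular factorizations of the second kind, of both `g` and `g^{-*}`, whose diagonal
constants are conjugate to each other. -/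
def TriangularTwo (s : ℝ) (g : Circle → Matrix.SpecialLinearGroup (Fin 2) ℂ) : Prop :=
  ∃ t : ℂ, t ≠ 0 ∧ HasUpperFactorization s (fun z => (g z).1) t ∧
    HasUpperFactorization s (invStar g) (conj t)

/-! On the circle, `g = (a, b; c^*, d^*)` has `g^{-*} = (d, -c; -b^*, a^*)`, so the first matrix
form says that the top rows of `g` and of `g^{-*}` are both boundary values of holomorphic rows. A
lower unipotent left factor does not touch the top row, so the factorizations give back the matrix
form at once, and determinant one in the disk forbids common zeros. The second kind is the same with
bottom rows.

The other direction completes a holomorphic row `(a, b)` (`exists_holomorphic_completion`). By the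
determinant on the circle, `a` and `b` have no common zero on the closed disk, so Bezout in the disk
algebra provides a holomorphic row `(u, v)` with `a v - b u = 1`. The actual second row `(p, q)`
satisfies the same equation on the circle, hence differs from `(u, v)` by a scalar multiple `w (a,
b)`. Splitting `w` into a holomorphic and an antiholomorphic part puts the former into the right
factor and the latter into the unipotent left factor; a constant then adjusts the normalization.

Two analytic facts carry this. The splitting stays in `C^s` by Privalov's theorem, which needs the
fractional part of `s` to lie strictly between `0` and `1`. Bezout holds because the characters of
the disk algebra are the point evaluations. -/

/-! ### Periodic Hölder functions and their algebra -/

/-- A `2π`-periodic function on the line with global Hölder exponent `α`. -/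
def PeriodicHolder (α : ℝ) (f : ℝ → ℂ) : Prop :=
  Function.Periodic f (2 * Real.pi) ∧ ∃ C, 0 ≤ C ∧ ∀ x y, ‖f x - f y‖ ≤ C * |x - y| ^ α

/-- A `2π`-periodic function on the line whose derivatives of order up to `k` exist, the `k`-th one
being Hölder continuous with exponent `α`. -/
def PeriodicHolderDeriv (α : ℝ) : ℕ → (ℝ → ℂ) → Prop
  | 0, f => PeriodicHolder α f
  | k + 1, f => Function.Periodic f (2 * Real.pi) ∧ Differentiable ℝ f ∧
      PeriodicHolderDeriv α k (deriv f)

theorem Function.Periodic.deriv_periodic {f : ℝ → ℂ} {c : ℝ} (hf : Function.Periodic f c) :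
    Function.Periodic (deriv f) c := by
  intro x
  rw [← deriv_comp_add_const]
  congr 1
  exact funext hf

theorem PeriodicHolder.continuous {α : ℝ} (hα : 0 < α) {f : ℝ → ℂ} (hf : PeriodicHolder α f) :
    Continuous f := by
  obtain ⟨-, C, hC, h⟩ := hf
  rw [continuous_iff_continuousAt]
  intro x
  rw [ContinuousAt, tendsto_iff_norm_sub_tendsto_zero]
  refine squeeze_zero (fun _ => norm_nonneg _) (fun y => h y x) ?_
  have : Continuous fun y : ℝ => C * |y - x| ^ α :=
    continuous_const.mul ((continuous_id.sub continuous_const).abs.rpow_const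
      (fun _ => Or.inr hα.le))
  simpa [Real.zero_rpow hα.ne'] using this.tendsto x

theorem Function.Periodic.exists_norm_le {f : ℝ → ℂ} (hp : Function.Periodic f (2 * Real.pi))
    (hf : Continuous f) : ∃ M, 0 ≤ M ∧ ∀ x, ‖f x‖ ≤ M := by
  obtain ⟨M, hM⟩ := (isCompact_Icc (a := (0 : ℝ)) (b := 2 * Real.pi)).exists_bound_of_continuousOn
    hf.continuousOn
  have h : ∀ x, ‖f x‖ ≤ M := by
    intro x
    obtain ⟨y, hy, hxy⟩ := hp.exists_mem_Ico₀ Real.two_pi_pos x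
    rw [hxy]
    exact hM y (Set.Ico_subset_Icc_self hy)
  exact ⟨M, (norm_nonneg _).trans (h 0), h⟩

/-- An increment longer than `δ` has `|x - y| ^ α ≥ δ ^ α`, so the oscillation bound `M` is absorbed
by the constant `M / δ ^ α`. Only short increments then need estimating. -/
theorem periodicHolder_of_local {α : ℝ} (hα : 0 < α) {f : ℝ → ℂ} {C M δ : ℝ} (hδ : 0 < δ)
    (hp : Function.Periodic f (2 * Real.pi)) (hM : ∀ x y, ‖f x - f y‖ ≤ M)
    (hC : ∀ x y, |x - y| ≤ δ → ‖f x - f y‖ ≤ C * |x - y| ^ α) : PeriodicHolder α f := by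
  refine ⟨hp, max C 0 + M / δ ^ α, ?_, ?_⟩
  · have : 0 ≤ M := (norm_nonneg _).trans (hM 0 0)
    positivity
  · intro x y
    have hM0 : 0 ≤ M := (norm_nonneg _).trans (hM 0 0)
    have hδα : 0 < δ ^ α := Real.rpow_pos_of_pos hδ α
    have hp0 : 0 ≤ |x - y| ^ α := Real.rpow_nonneg (abs_nonneg _) _
    rw [add_mul]
    rcases le_total |x - y| δ with h | h
    · have h1 := hC x y h
      have h2 : C * |x - y| ^ α ≤ max C 0 * |x - y| ^ α :=
        mul_le_mul_of_nonneg_right (le_max_left _ _) hp0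
      have h3 : 0 ≤ M / δ ^ α * |x - y| ^ α := by positivity
      linarith
    · have h1 : δ ^ α ≤ |x - y| ^ α := Real.rpow_le_rpow hδ.le h hα.le
      have h2 : M ≤ M / δ ^ α * |x - y| ^ α := by
        rw [div_mul_eq_mul_div, le_div_iff₀ hδα]
        exact mul_le_mul_of_nonneg_left h1 hM0
      have h3 : 0 ≤ max C 0 * |x - y| ^ α := mul_nonneg (le_max_right _ _) hp0
      linarith [hM x y]

theorem periodicHolder_of_deriv {α : ℝ} (hα : 0 < α) (hα1 : α ≤ 1) {f : ℝ → ℂ}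
    (hp : Function.Periodic f (2 * Real.pi)) (hf : Differentiable ℝ f)
    (hc : Continuous (deriv f)) : PeriodicHolder α f := by
  obtain ⟨B, hB, hB'⟩ := hp.deriv_periodic.exists_norm_le hc
  obtain ⟨M, hM, hM'⟩ := hp.exists_norm_le hf.continuous
  refine periodicHolder_of_local hα one_pos (C := B) (M := M + M) hp
    (fun x y => (norm_sub_le _ _).trans (add_le_add (hM' x) (hM' y))) ?_
  intro x y hxy
  have h1 := Convex.norm_image_sub_le_of_norm_deriv_le (f := f) (fun x _ => hf x)
    (fun x _ => hB' x) convex_univ (Set.mem_univ y) (Set.mem_univ x)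
  refine h1.trans (mul_le_mul_of_nonneg_left ?_ hB)
  rw [Real.norm_eq_abs]
  exact Real.self_le_rpow_of_le_one (abs_nonneg _) hxy hα1

namespace PeriodicHolderDeriv

variable {α : ℝ} {k : ℕ} {f g : ℝ → ℂ}

theorem periodic (hf : PeriodicHolderDeriv α k f) : Function.Periodic f (2 * Real.pi) := by
  cases k <;> exact hf.1

theorem continuous (hα : 0 < α) (hf : PeriodicHolderDeriv α k f) : Continuous f := by
  cases k with
  | zero => exact PeriodicHolder.continuous hα hf
  | succ k => exact hf.2.1.continuous

theorem periodicHolder (hα : 0 < α) (hα1 : α ≤ 1) (hf : PeriodicHolderDeriv α k f) :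
    PeriodicHolder α f := by
  cases k with
  | zero => exact hf
  | succ k => exact periodicHolder_of_deriv hα hα1 hf.1 hf.2.1 (hf.2.2.continuous hα)

theorem of_succ (hα : 0 < α) (hα1 : α ≤ 1) (hf : PeriodicHolderDeriv α (k + 1) f) :
    PeriodicHolderDeriv α k f := by
  induction k generalizing f with
  | zero => exact hf.periodicHolder hα hα1
  | succ k ih => exact ⟨hf.1, hf.2.1, ih hf.2.2⟩

theorem const (k : ℕ) (c : ℂ) : PeriodicHolderDeriv α k (fun _ => c) := by
  induction k generalizing c with
  | zero =>
    refine ⟨fun _ => rfl, 0, le_rfl, fun x y => ?_⟩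
    simp
  | succ k ih =>
    refine ⟨fun _ => rfl, differentiable_const c, ?_⟩
    rw [deriv_const']
    exact ih 0

theorem add (hf : PeriodicHolderDeriv α k f) (hg : PeriodicHolderDeriv α k g) :
    PeriodicHolderDeriv α k (fun x => f x + g x) := by
  induction k generalizing f g with
  | zero =>
    obtain ⟨hp, C, hC, h⟩ := hf
    obtain ⟨hp', C', hC', h'⟩ := hg
    refine ⟨hp.add hp', C + C', by positivity, fun x y => ?_⟩
    have : f x + g x - (f y + g y) = (f x - f y) + (g x - g y) := by ring
    rw [this, add_mul]
    exact (norm_add_le _ _).trans (add_le_add (h x y) (h' x y))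
  | succ k ih =>
    refine ⟨hf.1.add hg.1, hf.2.1.add hg.2.1, ?_⟩
    have : deriv (fun x => f x + g x) = fun x => deriv f x + deriv g x :=
      funext fun x => deriv_fun_add (hf.2.1 x) (hg.2.1 x)
    rw [this]
    exact ih hf.2.2 hg.2.2

theorem mul (hα : 0 < α) (hα1 : α ≤ 1) (hf : PeriodicHolderDeriv α k f)
    (hg : PeriodicHolderDeriv α k g) : PeriodicHolderDeriv α k (fun x => f x * g x) := by
  induction k generalizing f g with
  | zero =>
    obtain ⟨M, hM, hfM⟩ := hf.periodic.exists_norm_le (hf.continuous hα)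
    obtain ⟨M', hM', hgM⟩ := hg.periodic.exists_norm_le (hg.continuous hα)
    obtain ⟨hp, C, hC, h⟩ := hf
    obtain ⟨hp', C', hC', h'⟩ := hg
    refine ⟨hp.mul hp', M * C' + C * M', by positivity, fun x y => ?_⟩
    have : f x * g x - f y * g y = f x * (g x - g y) + (f x - f y) * g y := by ring
    rw [this]
    calc _ ≤ ‖f x‖ * ‖g x - g y‖ + ‖f x - f y‖ * ‖g y‖ := by
          rw [← norm_mul, ← norm_mul]; exact norm_add_le _ _
      _ ≤ M * (C' * |x - y| ^ α) + C * |x - y| ^ α * M' := by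
          gcongr
          · exact hfM x
          · exact h' x y
          · exact h x y
          · exact hgM y
      _ = _ := by ring
  | succ k ih =>
    refine ⟨hf.1.mul hg.1, hf.2.1.mul hg.2.1, ?_⟩
    have : deriv (fun x => f x * g x) = fun x => deriv f x * g x + f x * deriv g x :=
      funext fun x => deriv_fun_mul (hf.2.1 x) (hg.2.1 x)
    rw [this]
    exact (ih hf.2.2 (hg.of_succ hα hα1)).add (ih (hf.of_succ hα hα1) hg.2.2)

theorem inv (hα : 0 < α) (hα1 : α ≤ 1) (hf : PeriodicHolderDeriv α k f) (h0 : ∀ x, f x ≠ 0) :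
    PeriodicHolderDeriv α k (fun x => (f x)⁻¹) := by
  have hpi : Function.Periodic (fun x => (f x)⁻¹) (2 * Real.pi) := fun x => by
    simp only [hf.periodic x]
  induction k with
  | zero =>
    obtain ⟨M, hM, hfM⟩ := hpi.exists_norm_le ((hf.continuous hα).inv₀ h0)
    obtain ⟨hp, C, hC, h⟩ := hf
    refine ⟨hpi, M * C * M, by positivity, fun x y => ?_⟩
    have : (f x)⁻¹ - (f y)⁻¹ = (f x)⁻¹ * (f y - f x) * (f y)⁻¹ := by
      have hx := h0 x
      have hy := h0 y
      field_simp
    rw [this, norm_mul, norm_mul]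
    calc _ ≤ M * (C * |x - y| ^ α) * M := by
          gcongr
          · exact hfM x
          · rw [norm_sub_rev]; exact h x y
          · exact hfM y
      _ = _ := by ring
  | succ k ih =>
    refine ⟨hpi, fun x => (hf.2.1 x).inv (h0 x), ?_⟩
    have hi := ih (hf.of_succ hα hα1)
    have : deriv (fun x => (f x)⁻¹) =
        fun x => (-1) * (deriv f x * ((f x)⁻¹ * (f x)⁻¹)) := by
      funext x
      rw [deriv_fun_inv'' (hf.2.1 x) (h0 x)]
      have hx := h0 x
      field_simp
    rw [this]
    exact (const k _).mul hα hα1 (hf.2.2.mul hα hα1 (hi.mul hα hα1 hi))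

theorem star (hf : PeriodicHolderDeriv α k f) : PeriodicHolderDeriv α k (fun x => conj (f x)) := by
  have hpi : Function.Periodic (fun x => conj (f x)) (2 * Real.pi) := fun x => by
    simp only [hf.periodic x]
  induction k generalizing f with
  | zero =>
    obtain ⟨hp, C, hC, h⟩ := hf
    refine ⟨hpi, C, hC, fun x y => ?_⟩
    rw [← map_sub, RCLike.norm_conj]
    exact h x y
  | succ k ih =>
    have hd : ∀ x, HasDerivAt (fun x => conj (f x)) (conj (deriv f x)) x := fun x =>
      (hf.2.1 x).hasDerivAt.star
    refine ⟨hpi, fun x => (hd x).differentiableAt, ?_⟩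
    rw [funext fun x => (hd x).deriv]
    exact ih hf.2.2 (fun x => by simp only [hf.2.2.periodic x])

end PeriodicHolderDeriv

theorem periodicHolderDeriv_exp {α : ℝ} (hα : 0 < α) (hα1 : α ≤ 1) (k : ℕ) :
    PeriodicHolderDeriv α k (fun θ : ℝ => (Circle.exp θ : ℂ)) := by
  have hd : ∀ θ : ℝ, HasDerivAt (fun θ : ℝ => (Circle.exp θ : ℂ))
      (Complex.I * (Circle.exp θ : ℂ)) θ := by
    intro θ
    simp only [Circle.coe_exp]
    have := ((Complex.ofRealCLM.hasDerivAt (x := θ)).mul_const Complex.I).cexp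
    simpa [mul_comm] using this
  have hp : Function.Periodic (fun θ : ℝ => (Circle.exp θ : ℂ)) (2 * Real.pi) := fun θ => by
    simp only [Circle.periodic_exp θ]
  have hde := funext fun x => (hd x).deriv
  have hdiff : Differentiable ℝ (fun θ : ℝ => (Circle.exp θ : ℂ)) :=
    fun x => (hd x).differentiableAt
  induction k with
  | zero =>
    refine periodicHolder_of_deriv hα hα1 hp hdiff ?_
    rw [hde]
    exact continuous_const.mul hdiff.continuous
  | succ k ih =>
    refine ⟨hp, hdiff, ?_⟩
    rw [hde]
    exact (PeriodicHolderDeriv.const k _).mul hα hα1 ih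

/-- The recursive form lets algebra and Privalov's theorem be proved by induction through `deriv`;
this lemma links it to `ContDiff` and `HolderWith`. -/
theorem periodicHolderDeriv_iff {α : ℝ} (hα : 0 < α) (k : ℕ) (f : ℝ → ℂ) :
    PeriodicHolderDeriv α k f ↔ Function.Periodic f (2 * Real.pi) ∧ ContDiff ℝ k f ∧
      ∃ C : NNReal, HolderWith C α.toNNReal (iteratedDeriv k f) := by
  induction k generalizing f with
  | zero =>
    simp only [iteratedDeriv_zero, Nat.cast_zero]
    constructor
    · intro h
      refine ⟨h.periodic, contDiff_zero.2 (h.continuous hα), ?_⟩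
      obtain ⟨-, C, hC, h⟩ := h
      refine ⟨C.toNNReal, fun x y => ?_⟩
      rw [edist_dist, edist_dist, Real.coe_toNNReal _ hα.le, dist_eq_norm, Real.dist_eq,
        ENNReal.ofReal_rpow_of_nonneg (abs_nonneg _) hα.le, ← ENNReal.ofReal.eq_1 C,
        ← ENNReal.ofReal_mul hC]
      exact ENNReal.ofReal_le_ofReal (h x y)
    · rintro ⟨hp, -, C, h⟩
      refine ⟨hp, C, C.2, fun x y => ?_⟩
      have := h.dist_le x y
      rwa [Real.coe_toNNReal _ hα.le, dist_eq_norm, Real.dist_eq] at this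
  | succ k ih =>
    rw [PeriodicHolderDeriv, ih, iteratedDeriv_succ', Nat.cast_succ, contDiff_succ_iff_deriv]
    constructor
    · rintro ⟨h1, h2, h3, h4, h5⟩
      exact ⟨h1, ⟨h2, by simp, h4⟩, h5⟩
    · rintro ⟨h1, ⟨h2, -, h4⟩, h5⟩
      exact ⟨h1, h2, h1.deriv_periodic, h4, h5⟩

theorem isCsOnCircle_iff {s : ℝ} (hs : 0 < s - (⌊s⌋₊ : ℝ)) (φ : Circle → ℂ) :
    IsCsOnCircle s φ ↔
      PeriodicHolderDeriv (s - (⌊s⌋₊ : ℝ)) ⌊s⌋₊ (fun θ : ℝ => φ (Circle.exp θ)) := by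
  rw [periodicHolderDeriv_iff hs, IsCsOnCircle]
  exact ⟨fun h => ⟨fun θ => by simp only [Circle.periodic_exp θ], h⟩, fun h => h.2⟩

/-! ### Estimates for the Cauchy kernel near the circle -/

theorem norm_circleExp_sub_one_le (t : ℝ) : ‖(Circle.exp t : ℂ) - 1‖ ≤ |t| := by
  rw [Circle.coe_exp, mul_comm]
  exact Real.norm_exp_I_mul_ofReal_sub_one_le

theorem one_sub_le_norm_circleExp_sub {r t : ℝ} (hr : 0 ≤ r) :
    1 - r ≤ ‖(Circle.exp t : ℂ) - r‖ := by
  have := norm_sub_norm_le (Circle.exp t : ℂ) (r : ℂ)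
  rwa [Circle.norm_coe, Complex.norm_real, Real.norm_of_nonneg hr] at this

/-- Jordan's inequality gives `2|t|/π` for `r = 1`. Moving from `1` to `r` costs `1 - r`, which is
itself at most the distance being bounded, so half of it survives. -/
theorem abs_div_pi_le_norm_circleExp_sub {r t : ℝ} (hr : 0 ≤ r) (hr1 : r ≤ 1)
    (ht : |t| ≤ Real.pi) : |t| / Real.pi ≤ ‖(Circle.exp t : ℂ) - r‖ := by
  have h1 : 2 / Real.pi * |t| ≤ ‖(Circle.exp t : ℂ) - 1‖ := by
    rw [Circle.coe_exp, mul_comm (t : ℂ), Complex.norm_exp_I_mul_ofReal_sub_one, norm_mul,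
      Real.norm_eq_abs, Real.norm_eq_abs, abs_two]
    have := Real.mul_abs_le_abs_sin (x := t / 2) (by rw [abs_div, abs_two]; linarith)
    rw [abs_div, abs_two] at this
    linarith
  have h2 : ‖(Circle.exp t : ℂ) - 1‖ ≤ ‖(Circle.exp t : ℂ) - r‖ + ‖(r : ℂ) - 1‖ :=
    norm_sub_le_norm_sub_add_norm_sub _ _ _
  have h3 : ‖(r : ℂ) - 1‖ = 1 - r := by
    rw [← Complex.ofReal_one, ← Complex.ofReal_sub, Complex.norm_real, Real.norm_eq_abs,
      abs_sub_comm, abs_of_nonneg (by linarith)]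
  have h4 := one_sub_le_norm_circleExp_sub (t := t) hr
  have : |t| / Real.pi = 2 / Real.pi * |t| / 2 := by ring
  rw [this]
  linarith

theorem circleExp_sub_ne_zero {r t : ℝ} (hr : 0 ≤ r) (hr1 : r ≤ 1) (ht : |t| ≤ Real.pi)
    (ht0 : t ≠ 0) : (Circle.exp t : ℂ) - r ≠ 0 := by
  have := abs_div_pi_le_norm_circleExp_sub hr hr1 ht
  have h : 0 < |t| / Real.pi := div_pos (abs_pos.2 ht0) Real.pi_pos
  exact norm_pos_iff.1 (h.trans_le this)

theorem norm_inv_circleExp_sub_le {δ t : ℝ} (hδ : 0 < δ) (hδ1 : δ ≤ 1) (ht : |t| ≤ Real.pi)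
    (ht0 : t ≠ 0) :
    ‖(Circle.exp t : ℂ) - (1 - δ : ℝ)‖⁻¹ ≤ Real.pi / δ * min 1 (δ / |t|) := by
  have h1 := abs_div_pi_le_norm_circleExp_sub (r := 1 - δ) (by linarith) (by linarith) ht
  have h2 := one_sub_le_norm_circleExp_sub (r := 1 - δ) (t := t) (by linarith)
  rw [sub_sub_cancel] at h2
  have ht1 : 0 < |t| := abs_pos.2 ht0
  have hpi := Real.pi_pos
  rcases min_choice 1 (δ / |t|) with h | h <;> rw [h]
  · refine (inv_anti₀ hδ h2).trans ?_
    rw [mul_one, inv_eq_one_div]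
    gcongr
    linarith [Real.pi_gt_three]
  · refine (inv_anti₀ (by positivity) h1).trans (le_of_eq ?_)
    field_simp

theorem intervalIntegrable_abs_rpow {α : ℝ} (hα : 0 < α) (a b : ℝ) :
    IntervalIntegrable (fun t : ℝ => |t| ^ (α - 1)) MeasureTheory.volume a b := by
  have key : ∀ c, 0 ≤ c →
      IntervalIntegrable (fun t : ℝ => |t| ^ (α - 1)) MeasureTheory.volume 0 c := by
    intro c hc
    refine (intervalIntegral.intervalIntegrable_rpow' (r := α - 1) (by linarith)).congr ?_
    intro t ht
    rw [Set.uIoc_of_le hc] at ht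
    simp only [abs_of_pos ht.1]
  have key2 : ∀ c,
      IntervalIntegrable (fun t : ℝ => |t| ^ (α - 1)) MeasureTheory.volume 0 c := by
    intro c
    rcases le_total 0 c with hc | hc
    · exact key c hc
    · have := (IntervalIntegrable.iff_comp_neg).1 (key (-c) (by linarith))
      simpa using this
  exact (key2 a).symm.trans (key2 b)

/-- Split at `|t| = δ`. Inside, the minimum is at most `1` and `α > 0` gives `δ ^ α / α`; outside,
the integrand is at most `δ * t ^ (α - 2)` and `α < 1` gives `δ ^ α / (1 - α)`. The factor `2`
accounts for both signs of `t`. -/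
theorem integral_abs_rpow_mul_min_le {α δ : ℝ} (hα : 0 < α) (hα1 : α < 1) (hδ : 0 < δ)
    (hδ1 : δ ≤ 1) :
    IntervalIntegrable (fun t : ℝ => |t| ^ (α - 1) * min 1 (δ / |t|)) MeasureTheory.volume
      (-Real.pi) Real.pi ∧
    ∫ t in (-Real.pi)..Real.pi, |t| ^ (α - 1) * min 1 (δ / |t|) ≤
      2 * (1 / α + 1 / (1 - α)) * δ ^ α := by
  set g : ℝ → ℝ := fun t => |t| ^ (α - 1) * min 1 (δ / |t|) with hg
  have hgi : ∀ a b, IntervalIntegrable g MeasureTheory.volume a b := by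
    intro a b
    refine (intervalIntegrable_abs_rpow hα a b).mono_fun ?_ ?_
    · refine Measurable.aestronglyMeasurable ?_
      fun_prop
    · refine Filter.Eventually.of_forall fun t => ?_
      have h0 : 0 ≤ |t| ^ (α - 1) := Real.rpow_nonneg (abs_nonneg _) _
      have h1 : 0 ≤ min 1 (δ / |t|) := le_min zero_le_one (by positivity)
      simp only [hg]
      rw [norm_mul, Real.norm_of_nonneg h1]
      exact mul_le_of_le_one_right (norm_nonneg _) (min_le_left _ _)
  refine ⟨hgi _ _, ?_⟩
  have hδpi : δ ≤ Real.pi := by linarith [Real.pi_gt_three]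
  have hneg : ∫ t in (-Real.pi)..0, g t = ∫ t in (0 : ℝ)..Real.pi, g t := by
    have := intervalIntegral.integral_comp_neg (a := 0) (b := Real.pi) g
    rw [neg_zero] at this
    rw [← this]
    simp [hg]
  rw [← intervalIntegral.integral_add_adjacent_intervals (hgi _ 0) (hgi 0 _), hneg,
    ← intervalIntegral.integral_add_adjacent_intervals (hgi 0 δ) (hgi δ _)]
  have hα' : (0 : ℝ) < 1 - α := by linarith
  have h1 : ∫ t in (0 : ℝ)..δ, g t ≤ δ ^ α / α := by
    have : ∫ t in (0 : ℝ)..δ, t ^ (α - 1) = δ ^ α / α := by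
      rw [integral_rpow (Or.inl (by linarith)), sub_add_cancel, Real.zero_rpow hα.ne', sub_zero]
    rw [← this]
    refine intervalIntegral.integral_mono_on hδ.le (hgi _ _)
      (intervalIntegral.intervalIntegrable_rpow' (by linarith)) fun t ht => ?_
    simp only [hg, abs_of_nonneg ht.1]
    exact mul_le_of_le_one_right (Real.rpow_nonneg ht.1 _) (min_le_left _ _)
  have h2 : ∫ t in δ..Real.pi, g t ≤ δ ^ α / (1 - α) := by
    have hnot : (0 : ℝ) ∉ Set.uIcc δ Real.pi := by
      rw [Set.uIcc_of_le hδpi]; exact fun h => absurd h.1 (not_le.2 hδ)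
    have hle : ∫ t in δ..Real.pi, g t ≤ ∫ t in δ..Real.pi, δ * t ^ (α - 2) := by
      refine intervalIntegral.integral_mono_on hδpi (hgi _ _)
        ((intervalIntegral.intervalIntegrable_rpow (Or.inr hnot)).const_mul δ) fun t ht => ?_
      have ht0 : 0 < t := hδ.trans_le ht.1
      simp only [hg, abs_of_pos ht0]
      calc _ ≤ t ^ (α - 1) * (δ / t) := by gcongr; exact min_le_right _ _
        _ = δ * t ^ (α - 2) := by
          rw [show α - 2 = α - 1 - 1 by ring, Real.rpow_sub_one ht0.ne' (α - 1)]; ring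
    refine hle.trans ?_
    rw [intervalIntegral.integral_const_mul,
      integral_rpow (Or.inr ⟨by linarith, hnot⟩), show α - 2 + 1 = α - 1 by ring]
    have hp : 0 ≤ Real.pi ^ (α - 1) := Real.rpow_nonneg Real.pi_pos.le _
    have : δ * ((Real.pi ^ (α - 1) - δ ^ (α - 1)) / (α - 1)) =
        (δ * δ ^ (α - 1) - δ * Real.pi ^ (α - 1)) / (1 - α) := by
      have h3 : α - 1 ≠ 0 := by linarith
      field_simp
      ring
    rw [this]
    gcongr
    have : δ * δ ^ (α - 1) = δ ^ α := by
      rw [Real.rpow_sub_one hδ.ne']; field_simp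
    rw [this]
    have : 0 ≤ δ * Real.pi ^ (α - 1) := by positivity
    linarith
  have : 2 * (1 / α + 1 / (1 - α)) * δ ^ α =
      (δ ^ α / α + δ ^ α / (1 - α)) + (δ ^ α / α + δ ^ α / (1 - α)) := by ring
  rw [this]
  linarith

/-! ### The Cauchy integral and its regularization up to the boundary -/

/-- The Cauchy integral over the unit circle of a function given in the angular variable. -/
noncomputable def cauchyTransform (w : ℝ → ℂ) (z : ℂ) : ℂ :=
  (2 * Real.pi : ℂ)⁻¹ *
    ∫ t in (-Real.pi)..Real.pi, (Circle.exp t : ℂ) / ((Circle.exp t : ℂ) - z) * w t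

/-- The Cauchy integral at `ζ * exp (i φ)`, with the value at `φ` subtracted under the integral
sign, so that it makes sense at the boundary point `ζ = 1` too. -/
noncomputable def regularizedCauchy (w : ℝ → ℂ) (φ : ℝ) (ζ : ℂ) : ℂ :=
  w φ + (2 * Real.pi : ℂ)⁻¹ * ∫ t in (-Real.pi)..Real.pi,
    (w (φ + t) - w φ) * ((Circle.exp t : ℂ) / ((Circle.exp t : ℂ) - ζ))

theorem Function.Periodic.apply_arg_circleExp {β : Type*} {w : ℝ → β}
    (hp : Function.Periodic w (2 * Real.pi)) (θ : ℝ) :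
    w (Complex.arg (Circle.exp θ : ℂ)) = w θ := by
  rw [Circle.coe_exp, Complex.arg_exp_mul_I, toIocMod]
  exact hp.sub_zsmul_eq _

theorem cauchyTransform_eq_circleIntegral {w : ℝ → ℂ} (hp : Function.Periodic w (2 * Real.pi))
    (z : ℂ) : cauchyTransform w z =
      (2 * Real.pi * Complex.I)⁻¹ • ∮ ζ in C(0, 1), (ζ - z)⁻¹ • w ζ.arg := by
  have hper : Function.Periodic
      (fun t => (Circle.exp t : ℂ) / ((Circle.exp t : ℂ) - z) * w t) (2 * Real.pi) := by
    intro t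
    simp only [Circle.periodic_exp t, hp t]
  have h1 := hper.intervalIntegral_add_eq (-Real.pi) 0
  rw [show -Real.pi + 2 * Real.pi = Real.pi by ring, zero_add] at h1
  rw [cauchyTransform, h1, circleIntegral, mul_inv (2 * Real.pi : ℂ), smul_eq_mul, mul_assoc]
  congr 1
  rw [← intervalIntegral.integral_const_mul]
  congr 1
  funext θ
  have h2 : circleMap 0 1 θ = (Circle.exp θ : ℂ) := by simp [circleMap]
  rw [deriv_circleMap, h2, hp.apply_arg_circleExp, smul_eq_mul, smul_eq_mul]
  have := Complex.I_ne_zero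
  field_simp

theorem differentiableOn_cauchyTransform {w : ℝ → ℂ} (hp : Function.Periodic w (2 * Real.pi))
    (hw : Continuous w) : DifferentiableOn ℂ (cauchyTransform w) (Metric.ball 0 1) := by
  have hci : CircleIntegrable (fun ζ : ℂ => w ζ.arg) 0 ((1 : NNReal) : ℝ) := by
    refine (hw.intervalIntegrable 0 (2 * Real.pi)).congr fun θ _ => ?_
    have h2 : circleMap 0 ((1 : NNReal) : ℝ) θ = (Circle.exp θ : ℂ) := by simp [circleMap]
    simp only [h2, hp.apply_arg_circleExp]
  have h := (hasFPowerSeriesOn_cauchy_integral hci one_pos).differentiableOn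
  rw [Metric.eball_coe] at h
  refine h.congr fun z _ => ?_
  rw [cauchyTransform_eq_circleIntegral hp]
  rfl

theorem cauchyTransform_one {z : ℂ} (hz : ‖z‖ < 1) : cauchyTransform (fun _ => 1) z = 1 := by
  rw [cauchyTransform_eq_circleIntegral (fun _ => rfl)]
  simp only [smul_eq_mul, mul_one]
  rw [circleIntegral.integral_sub_inv_of_mem_ball (by simpa using hz)]
  have : (2 * Real.pi * Complex.I : ℂ) ≠ 0 := by
    simp [Real.pi_ne_zero]
  field_simp

theorem continuous_circleExp_div {ζ : ℂ} (hζ : ‖ζ‖ < 1) :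
    Continuous fun t : ℝ => (Circle.exp t : ℂ) / ((Circle.exp t : ℂ) - ζ) := by
  refine Continuous.div (by fun_prop) (by fun_prop) fun t h => ?_
  rw [← sub_eq_zero.1 h, Circle.norm_coe] at hζ
  exact lt_irrefl _ hζ

/-- Rotate the variable of integration by `φ`. Since the kernel has mean `1` for `‖ζ‖ < 1`, the part
subtracted under the integral is exactly `w φ`. -/
theorem cauchyTransform_eq_regularizedCauchy {w : ℝ → ℂ}
    (hp : Function.Periodic w (2 * Real.pi)) (hw : Continuous w) (φ : ℝ) {ζ : ℂ} (hζ : ‖ζ‖ < 1) :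
    cauchyTransform w (Circle.exp φ * ζ) = regularizedCauchy w φ ζ := by
  have hc := continuous_circleExp_div hζ
  have h1 : cauchyTransform w (Circle.exp φ * ζ) = (2 * Real.pi : ℂ)⁻¹ *
      ∫ t in (-Real.pi)..Real.pi,
        w (φ + t) * ((Circle.exp t : ℂ) / ((Circle.exp t : ℂ) - ζ)) := by
    have hper : Function.Periodic (fun t => (Circle.exp t : ℂ) /
        ((Circle.exp t : ℂ) - Circle.exp φ * ζ) * w t) (2 * Real.pi) := by
      intro t
      simp only [Circle.periodic_exp t, hp t]
    have h1 := hper.intervalIntegral_add_eq (-Real.pi) (φ + -Real.pi)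
    rw [show -Real.pi + 2 * Real.pi = Real.pi by ring,
      show φ + -Real.pi + 2 * Real.pi = φ + Real.pi by ring] at h1
    rw [cauchyTransform, h1, ← intervalIntegral.integral_comp_add_left]
    congr 2
    funext t
    rw [Circle.exp_add, Circle.coe_mul, ← mul_sub, mul_div_mul_left _ _ (Circle.coe_ne_zero _),
      mul_comm]
  have h2 := cauchyTransform_one hζ
  rw [cauchyTransform] at h2
  simp only [mul_one] at h2
  rw [h1, regularizedCauchy]
  simp only [sub_mul]
  rw [intervalIntegral.integral_sub, intervalIntegral.integral_const_mul, mul_sub,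
    mul_left_comm _ (w φ), h2]
  · ring
  · exact ((hw.comp (continuous_const.add continuous_id)).mul hc).intervalIntegrable _ _
  · exact (continuous_const.mul hc).intervalIntegrable _ _

/-- The Hölder increment `|t| ^ α` tames the kernel singularity `π / |t|`. The resulting majorant is
integrable for `α > 0` and uniform in `r` up to `1`, so it serves all dominated convergence
arguments. -/
theorem PeriodicHolder.exists_kernel_bound {α : ℝ} (hα1 : α < 1) {w : ℝ → ℂ}
    (hw : PeriodicHolder α w) : ∃ C, 0 ≤ C ∧ ∀ r φ t : ℝ, 0 ≤ r → r ≤ 1 → |t| ≤ Real.pi →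
      ‖(w (φ + t) - w φ) * ((Circle.exp t : ℂ) / ((Circle.exp t : ℂ) - r))‖ ≤
        C * |t| ^ (α - 1) := by
  obtain ⟨-, C, hC, h⟩ := hw
  refine ⟨C * Real.pi, by positivity, fun r φ t hr hr1 ht => ?_⟩
  rcases eq_or_ne t 0 with rfl | ht0
  -- At `t = 0` both sides vanish, by the convention `0 ^ (α - 1) = 0`.
  · simp [Real.zero_rpow (by linarith : α - 1 ≠ 0)]
  have h1 := abs_div_pi_le_norm_circleExp_sub hr hr1 ht
  have h2 := h (φ + t) φ
  rw [add_sub_cancel_left] at h2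
  have ht1 : 0 < |t| := abs_pos.2 ht0
  rw [norm_mul, norm_div, Circle.norm_coe, Real.rpow_sub_one ht1.ne']
  calc _ ≤ C * |t| ^ α * (1 / (|t| / Real.pi)) := by
        have := Real.pi_pos
        gcongr
    _ = _ := by field_simp

theorem aestronglyMeasurable_kernel {w : ℝ → ℂ} (hw : Continuous w) (φ : ℝ) (ζ : ℂ)
    (μ : MeasureTheory.Measure ℝ) : MeasureTheory.AEStronglyMeasurable
      (fun t => (w (φ + t) - w φ) * ((Circle.exp t : ℂ) / ((Circle.exp t : ℂ) - ζ))) μ := by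
  have h1 : Measurable fun t => w (φ + t) - w φ :=
    ((hw.comp (continuous_const.add continuous_id)).sub continuous_const).measurable
  have h2 : Measurable fun t : ℝ => (Circle.exp t : ℂ) :=
    Continuous.measurable (by fun_prop)
  exact (h1.mul (h2.div (h2.sub_const ζ))).aestronglyMeasurable

theorem abs_le_pi_of_mem_uIoc {t : ℝ} (ht : t ∈ Set.uIoc (-Real.pi) Real.pi) : |t| ≤ Real.pi := by
  rw [Set.uIoc_of_le (by linarith [Real.pi_pos])] at ht
  exact abs_le.2 ⟨ht.1.le, ht.2⟩

theorem PeriodicHolder.intervalIntegrable_kernel {α : ℝ} (hα : 0 < α) (hα1 : α < 1) {w : ℝ → ℂ}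
    (hw : PeriodicHolder α w) {r : ℝ} (hr : 0 ≤ r) (hr1 : r ≤ 1) (φ : ℝ) :
    IntervalIntegrable (fun t => (w (φ + t) - w φ) *
      ((Circle.exp t : ℂ) / ((Circle.exp t : ℂ) - r))) MeasureTheory.volume
      (-Real.pi) Real.pi := by
  obtain ⟨C, -, hb⟩ := hw.exists_kernel_bound hα1
  refine ((intervalIntegrable_abs_rpow hα (-Real.pi) Real.pi).const_mul C).mono_fun'
    (aestronglyMeasurable_kernel (hw.continuous hα) _ _ _) ?_
  refine (MeasureTheory.ae_restrict_mem measurableSet_uIoc).mono fun t ht => ?_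
  exact hb r φ t hr hr1 (abs_le_pi_of_mem_uIoc ht)

theorem PeriodicHolder.exists_norm_regularizedCauchy_le {α : ℝ} (hα : 0 < α) (hα1 : α < 1)
    {w : ℝ → ℂ} (hw : PeriodicHolder α w) : ∃ M, ∀ φ, ‖regularizedCauchy w φ 1‖ ≤ M := by
  obtain ⟨C, hC, hb⟩ := hw.exists_kernel_bound hα1
  obtain ⟨M, hM, hwM⟩ := hw.1.exists_norm_le (hw.continuous hα)
  refine ⟨M + ‖(2 * Real.pi : ℂ)⁻¹‖ * ∫ t in (-Real.pi)..Real.pi, C * |t| ^ (α - 1),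
    fun φ => ?_⟩
  rw [regularizedCauchy]
  refine (norm_add_le _ _).trans (add_le_add (hwM φ) ?_)
  rw [norm_mul]
  refine mul_le_mul_of_nonneg_left ?_ (norm_nonneg _)
  refine intervalIntegral.norm_integral_le_of_norm_le (by linarith [Real.pi_pos]) ?_
    ((intervalIntegrable_abs_rpow hα _ _).const_mul C)
  refine Filter.Eventually.of_forall fun t ht => ?_
  have := hb 1 φ t zero_le_one le_rfl
    (abs_le_pi_of_mem_uIoc (by rwa [Set.uIoc_of_le (by linarith [Real.pi_pos])]))
  simpa using this

theorem PeriodicHolder.continuousOn_regularizedCauchy {α : ℝ} (hα : 0 < α) (hα1 : α < 1)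
    {w : ℝ → ℂ} (hw : PeriodicHolder α w) :
    ContinuousOn (fun p : ℝ × ℝ => regularizedCauchy w p.1 (p.2 : ℂ))
      (Set.univ ×ˢ Set.Icc 0 1) := by
  have hwc := hw.continuous hα
  obtain ⟨C, hC, hb⟩ := hw.exists_kernel_bound hα1
  rw [continuousOn_iff_continuous_domRestrict]
  refine (hwc.comp (continuous_fst.comp continuous_subtype_val)).add (continuous_const.mul ?_)
  refine intervalIntegral.continuous_of_dominated_interval
    (bound := fun t => C * |t| ^ (α - 1))
    (fun p => aestronglyMeasurable_kernel hwc _ _ _) ?_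
    ((intervalIntegrable_abs_rpow hα _ _).const_mul C) ?_
  · exact fun p => Filter.Eventually.of_forall fun t ht =>
      hb _ _ t p.2.2.1 p.2.2.2 (abs_le_pi_of_mem_uIoc ht)
  · filter_upwards [MeasureTheory.Measure.ae_ne MeasureTheory.volume (0 : ℝ)] with t ht0 ht
    refine Continuous.mul ?_ (Continuous.div continuous_const ?_ ?_)
    · exact (hwc.comp ((continuous_fst.comp continuous_subtype_val).add continuous_const)).sub
        (hwc.comp (continuous_fst.comp continuous_subtype_val))
    · exact continuous_const.sub (Complex.continuous_ofReal.comp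
        (continuous_snd.comp continuous_subtype_val))
    · exact fun p => circleExp_sub_ne_zero p.2.2.1 p.2.2.2 (abs_le_pi_of_mem_uIoc ht) ht0

/-- Rotation invariance makes the operator commute with `d/dφ`: differentiation under the integral
falls on `w` only, and the majorant for `deriv w` does not depend on `φ`. -/
theorem PeriodicHolder.hasDerivAt_regularizedCauchy {α : ℝ} (hα : 0 < α) (hα1 : α < 1)
    {w : ℝ → ℂ} (hw : PeriodicHolder α w) (hd : Differentiable ℝ w)
    (hw' : PeriodicHolder α (deriv w)) (φ : ℝ) :
    HasDerivAt (fun φ => regularizedCauchy w φ 1) (regularizedCauchy (deriv w) φ 1) φ := by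
  obtain ⟨C, hC, hb⟩ := hw'.exists_kernel_bound hα1
  have hint := hw.intervalIntegrable_kernel hα hα1 zero_le_one le_rfl φ
  have hmeas := aestronglyMeasurable_kernel (hw'.continuous hα) φ 1
    (MeasureTheory.volume.restrict (Set.uIoc (-Real.pi) Real.pi))
  have hbound : ∀ t ∈ Set.uIoc (-Real.pi) Real.pi, ∀ x,
      ‖(deriv w (x + t) - deriv w x) * ((Circle.exp t : ℂ) / ((Circle.exp t : ℂ) - 1))‖ ≤
        C * |t| ^ (α - 1) := fun t ht x => by
    have := hb 1 x t zero_le_one le_rfl (abs_le_pi_of_mem_uIoc ht)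
    rwa [Complex.ofReal_one] at this
  have hderiv : ∀ t x, HasDerivAt (fun x => (w (x + t) - w x) *
      ((Circle.exp t : ℂ) / ((Circle.exp t : ℂ) - 1)))
      ((deriv w (x + t) - deriv w x) * ((Circle.exp t : ℂ) / ((Circle.exp t : ℂ) - 1))) x :=
    fun t x => (((hd (x + t)).hasDerivAt.comp_add_const x t).sub (hd x).hasDerivAt).mul_const _
  rw [Complex.ofReal_one] at hint
  have key := (intervalIntegral.hasDerivAt_integral_of_dominated_loc_of_deriv_le
    (μ := MeasureTheory.volume) (a := -Real.pi) (b := Real.pi) (x₀ := φ)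
    (bound := fun t => C * |t| ^ (α - 1)) (s := Set.univ)
    (F := fun x t => (w (x + t) - w x) * ((Circle.exp t : ℂ) / ((Circle.exp t : ℂ) - 1)))
    (F' := fun x t => (deriv w (x + t) - deriv w x) *
      ((Circle.exp t : ℂ) / ((Circle.exp t : ℂ) - 1))) Filter.univ_mem
    (Filter.Eventually.of_forall fun x => aestronglyMeasurable_kernel hd.continuous x 1 _)
    hint hmeas
    (Filter.Eventually.of_forall fun t ht x _ => hbound t ht x)
    ((intervalIntegrable_abs_rpow hα _ _).const_mul C)
    (Filter.Eventually.of_forall fun t _ x _ => hderiv t x)).2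
  exact (hd φ).hasDerivAt.add (key.const_mul _)

/-! ### Privalov's theorem -/

/-- Comparison of the Cauchy integral at two points of the closed disk, one of which is
`(1 - δ) * exp (i φ)`. -/
theorem PeriodicHolder.exists_norm_regularizedCauchy_sub_le {α : ℝ} (hα : 0 < α) (hα1 : α < 1)
    {w : ℝ → ℂ} (hw : PeriodicHolder α w) :
    ∃ A, 0 ≤ A ∧ ∀ δ φ : ℝ, ∀ ζ : ℂ, 0 < δ → δ ≤ 1 → ‖ζ - (1 - δ : ℝ)‖ ≤ δ →
      (∀ t : ℝ, |t| ≤ Real.pi → |t| / (2 * Real.pi) ≤ ‖(Circle.exp t : ℂ) - ζ‖) →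
      ‖regularizedCauchy w φ ζ - regularizedCauchy w φ (1 - δ : ℝ)‖ ≤ A * δ ^ α := by
  have hwc := hw.continuous hα
  have hw0 := hw
  obtain ⟨-, C, hC, h⟩ := hw0
  set K := 2 * (1 / α + 1 / (1 - α))
  have hpi := Real.pi_pos
  have hK : 0 ≤ K := by
    have : 0 < 1 - α := by linarith
    positivity
  -- `C` is the Hölder constant, `2π` and `π` come from the lower bounds for the distances to `ζ`
  -- and to `1 - δ`, and `K` from the integral of the majorant.
  refine ⟨‖(2 * Real.pi : ℂ)⁻¹‖ * (2 * Real.pi ^ 2 * C * K), by positivity,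
    fun δ φ ζ hδ hδ1 hζ hlow => ?_⟩
  obtain ⟨hI, hIle⟩ := integral_abs_rpow_mul_min_le hα hα1 hδ hδ1
  have hint2 := hw.intervalIntegrable_kernel hα hα1 (r := 1 - δ) (by linarith) (by linarith) φ
  have hint1 : IntervalIntegrable (fun t => (w (φ + t) - w φ) *
      ((Circle.exp t : ℂ) / ((Circle.exp t : ℂ) - ζ))) MeasureTheory.volume
      (-Real.pi) Real.pi := by
    refine ((intervalIntegrable_abs_rpow hα (-Real.pi) Real.pi).const_mul
      (2 * Real.pi * C)).mono_fun' (aestronglyMeasurable_kernel hwc _ _ _) ?_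
    refine (MeasureTheory.ae_restrict_mem measurableSet_uIoc).mono fun t ht => ?_
    rcases eq_or_ne t 0 with rfl | ht0
    · simp [Real.zero_rpow (by linarith : α - 1 ≠ 0)]
    have h1 := hlow t (abs_le_pi_of_mem_uIoc ht)
    have h2 := h (φ + t) φ
    rw [add_sub_cancel_left] at h2
    have ht1 : 0 < |t| := abs_pos.2 ht0
    simp only
    rw [norm_mul, norm_div, Circle.norm_coe, Real.rpow_sub_one ht1.ne']
    calc _ ≤ C * |t| ^ α * (1 / (|t| / (2 * Real.pi))) := by gcongr
      _ = _ := by field_simp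
  rw [regularizedCauchy, regularizedCauchy, add_sub_add_left_eq_sub, ← mul_sub,
    ← intervalIntegral.integral_sub hint1 hint2, norm_mul, mul_assoc]
  refine mul_le_mul_of_nonneg_left ?_ (norm_nonneg _)
  calc _ ≤ ∫ t in (-Real.pi)..Real.pi, (2 * Real.pi ^ 2 * C) *
        (|t| ^ (α - 1) * min 1 (δ / |t|)) := by
        refine intervalIntegral.norm_integral_le_of_norm_le (by linarith) ?_ (hI.const_mul _)
        refine Filter.Eventually.of_forall fun t ht => ?_
        rw [← Set.uIoc_of_le (by linarith)] at ht
        have htpi := abs_le_pi_of_mem_uIoc ht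
        rcases eq_or_ne t 0 with rfl | ht0
        · simp
        have ht1 : 0 < |t| := abs_pos.2 ht0
        have h1 := hlow t htpi
        have h2 := h (φ + t) φ
        rw [add_sub_cancel_left] at h2
        have h3 := norm_inv_circleExp_sub_le hδ hδ1 htpi ht0
        have h4 := circleExp_sub_ne_zero (r := 1 - δ) (by linarith) (by linarith) htpi ht0
        have h5 : (Circle.exp t : ℂ) - ζ ≠ 0 :=
          norm_pos_iff.1 ((by positivity : 0 < |t| / (2 * Real.pi)).trans_le h1)
        -- The difference of two Cauchy kernels gains the factor `ζ - (1 - δ)`, of size at most `δ`,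
        -- against one more power of the singularity.
        have e : (w (φ + t) - w φ) * ((Circle.exp t : ℂ) / ((Circle.exp t : ℂ) - ζ)) -
            (w (φ + t) - w φ) *
              ((Circle.exp t : ℂ) / ((Circle.exp t : ℂ) - (1 - δ : ℝ))) =
            (w (φ + t) - w φ) * ((Circle.exp t : ℂ) * (ζ - (1 - δ : ℝ)) *
              ((Circle.exp t : ℂ) - ζ)⁻¹ * ((Circle.exp t : ℂ) - (1 - δ : ℝ))⁻¹) := by
          field_simp
          ring
        rw [e, norm_mul, norm_mul, norm_mul, norm_mul, Circle.norm_coe, one_mul, norm_inv,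
          norm_inv, Real.rpow_sub_one ht1.ne']
        calc _ ≤ C * |t| ^ α * (δ * (|t| / (2 * Real.pi))⁻¹ *
              (Real.pi / δ * min 1 (δ / |t|))) := by gcongr
          _ = _ := by field_simp
    _ = 2 * Real.pi ^ 2 * C * ∫ t in (-Real.pi)..Real.pi, |t| ^ (α - 1) * min 1 (δ / |t|) :=
        intervalIntegral.integral_const_mul _ _
    _ ≤ _ := by
        rw [mul_assoc (2 * Real.pi ^ 2 * C)]
        exact mul_le_mul_of_nonneg_left hIle (by positivity)

theorem regularizedCauchy_periodic {w : ℝ → ℂ} (hp : Function.Periodic w (2 * Real.pi)) (ζ : ℂ) :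
    Function.Periodic (fun φ => regularizedCauchy w φ ζ) (2 * Real.pi) := by
  intro φ
  have : ∀ t, w (φ + 2 * Real.pi + t) = w (φ + t) := fun t => by
    rw [add_right_comm]; exact hp _
  simp only [regularizedCauchy, hp φ, this]

/-- Privalov's theorem: the boundary values of the Cauchy integral of a Hölder continuous function
are Hölder continuous with the same exponent. -/
theorem PeriodicHolder.privalov {α : ℝ} (hα : 0 < α) (hα1 : α < 1)
    {w : ℝ → ℂ} (hw : PeriodicHolder α w) :
    PeriodicHolder α (fun φ => regularizedCauchy w φ 1) := by
  obtain ⟨A, hA, hAb⟩ := hw.exists_norm_regularizedCauchy_sub_le hα hα1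
  obtain ⟨M, hM⟩ := hw.exists_norm_regularizedCauchy_le hα hα1
  refine periodicHolder_of_local (δ := 1 / 2) (C := 3 * A * 2 ^ α) (M := M + M) hα (by norm_num)
    (regularizedCauchy_periodic hw.1 1)
    (fun x y => (norm_sub_le _ _).trans (add_le_add (hM x) (hM y))) ?_
  intro x y hxy
  rcases eq_or_ne x y with rfl | hne
  · simp [Real.zero_rpow hα.ne']
  -- Both boundary points are compared with interior points at depth `δ`. Rotation by `x - y` moves
  -- an interior point by at most `δ / 2`, half of its minimal distance to the circle, so its
  -- distances to circle points are at least halved.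
  set δ := 2 * |x - y| with hδdef
  have hδ : 0 < δ := by
    have := abs_pos.2 (sub_ne_zero.2 hne)
    positivity
  have hδ1 : δ ≤ 1 := by linarith
  have hpi := Real.pi_pos
  have hr : ‖((1 - δ : ℝ) : ℂ)‖ < 1 := by
    rw [Complex.norm_real, Real.norm_of_nonneg (by linarith)]; linarith
  have h1 : ∀ φ, ‖regularizedCauchy w φ 1 -
      regularizedCauchy w φ (1 - δ : ℝ)‖ ≤ A * δ ^ α := by
    intro φ
    refine hAb δ φ 1 hδ hδ1 ?_ fun t ht => ?_
    · rw [← Complex.ofReal_one, ← Complex.ofReal_sub, Complex.norm_real,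
        Real.norm_of_nonneg (by linarith)]
      linarith
    · have := abs_div_pi_le_norm_circleExp_sub zero_le_one le_rfl ht
      rw [Complex.ofReal_one] at this
      refine le_trans ?_ this
      gcongr
      linarith
  have hrot : ‖(Circle.exp (x - y) : ℂ) * (1 - δ : ℝ) - (1 - δ : ℝ)‖ ≤ δ / 2 := by
    rw [← sub_one_mul, norm_mul, Complex.norm_real, Real.norm_of_nonneg (by linarith)]
    have h2 := norm_circleExp_sub_one_le (x - y)
    nlinarith [norm_nonneg ((Circle.exp (x - y) : ℂ) - 1)]
  have h2 : ‖regularizedCauchy w x (1 - δ : ℝ) -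
      regularizedCauchy w y (1 - δ : ℝ)‖ ≤ A * δ ^ α := by
    -- The interior point on the ray of angle `x` is a rotated point in the frame of angle `y`, so
    -- the same comparison lemma applies.
    have e : regularizedCauchy w x (1 - δ : ℝ) =
        regularizedCauchy w y ((Circle.exp (x - y) : ℂ) * (1 - δ : ℝ)) := by
      rw [← cauchyTransform_eq_regularizedCauchy hw.1 (hw.continuous hα) x hr,
        ← cauchyTransform_eq_regularizedCauchy hw.1 (hw.continuous hα) y
          (by rwa [norm_mul, Circle.norm_coe, one_mul]), ← mul_assoc, ← Circle.coe_mul,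
        ← Circle.exp_add, add_sub_cancel]
    rw [e]
    refine hAb δ y _ hδ hδ1 (hrot.trans (by linarith)) fun t ht => ?_
    have h3 := abs_div_pi_le_norm_circleExp_sub (r := 1 - δ) (by linarith) (by linarith) ht
    have h4 := one_sub_le_norm_circleExp_sub (r := 1 - δ) (t := t) (by linarith)
    have h5 := norm_sub_le_norm_sub_add_norm_sub (Circle.exp t : ℂ)
      ((Circle.exp (x - y) : ℂ) * (1 - δ : ℝ)) (1 - δ : ℝ)
    have h6 : |t| / (2 * Real.pi) = |t| / Real.pi / 2 := by ring
    rw [h6]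
    linarith
  have e : 3 * A * 2 ^ α * |x - y| ^ α = A * δ ^ α + A * δ ^ α + A * δ ^ α := by
    rw [hδdef, Real.mul_rpow (by norm_num) (abs_nonneg _)]; ring
  rw [e]
  have e2 : regularizedCauchy w x 1 - regularizedCauchy w y 1 =
      (regularizedCauchy w x 1 - regularizedCauchy w x (1 - δ : ℝ)) +
      (regularizedCauchy w x (1 - δ : ℝ) - regularizedCauchy w y (1 - δ : ℝ)) -
      (regularizedCauchy w y 1 - regularizedCauchy w y (1 - δ : ℝ)) := by ring
  rw [e2]
  exact (norm_sub_le _ _).trans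
    (add_le_add ((norm_add_le _ _).trans (add_le_add (h1 x) h2)) (h1 y))

theorem PeriodicHolderDeriv.privalov {α : ℝ} (hα : 0 < α) (hα1 : α < 1) {k : ℕ}
    {w : ℝ → ℂ} (hw : PeriodicHolderDeriv α k w) :
    PeriodicHolderDeriv α k (fun φ => regularizedCauchy w φ 1) := by
  induction k generalizing w with
  | zero => exact PeriodicHolder.privalov hα hα1 hw
  | succ k ih =>
    have hd := (hw.periodicHolder hα hα1.le).hasDerivAt_regularizedCauchy hα hα1 hw.2.1
      (hw.2.2.periodicHolder hα hα1.le)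
    refine ⟨regularizedCauchy_periodic hw.1 1, fun φ => (hd φ).differentiableAt, ?_⟩
    rw [funext fun φ => (hd φ).deriv]
    exact ih hw.2.2

/-! ### Riesz decomposition into holomorphic and antiholomorphic parts -/

/-- On the circle the kernel `κ = e^{it} / (e^{it} - 1)` satisfies `κ + conj κ = 1`, so the two
singular integrals add up to the integral of `w (φ + t) - w φ`. -/
theorem PeriodicHolder.regularizedCauchy_add_conj {α : ℝ} (hα : 0 < α) (hα1 : α < 1)
    {w : ℝ → ℂ} (hw : PeriodicHolder α w) (φ : ℝ) :
    regularizedCauchy w φ 1 + conj (regularizedCauchy (fun t => conj (w t)) φ 1) =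
      w φ + (2 * Real.pi : ℂ)⁻¹ * ∫ t in (-Real.pi)..Real.pi, w t := by
  have hwc := hw.continuous hα
  have hi := hw.intervalIntegrable_kernel hα hα1 zero_le_one le_rfl φ
  simp only [Complex.ofReal_one] at hi
  have hconj : conj (∫ t in (-Real.pi)..Real.pi, (conj (w (φ + t)) - conj (w φ)) *
      ((Circle.exp t : ℂ) / ((Circle.exp t : ℂ) - 1))) =
      ∫ t in (-Real.pi)..Real.pi, (w (φ + t) - w φ) *
        conj ((Circle.exp t : ℂ) / ((Circle.exp t : ℂ) - 1)) := by
    rw [← intervalIntegral.intervalIntegral_conj]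
    simp
  have hκ : (∫ t in (-Real.pi)..Real.pi, (w (φ + t) - w φ) *
        conj ((Circle.exp t : ℂ) / ((Circle.exp t : ℂ) - 1))) =
      ∫ t in (-Real.pi)..Real.pi, ((w (φ + t) - w φ) - (w (φ + t) - w φ) *
        ((Circle.exp t : ℂ) / ((Circle.exp t : ℂ) - 1))) := by
    refine intervalIntegral.integral_congr_ae ?_
    filter_upwards [MeasureTheory.Measure.ae_ne MeasureTheory.volume (0 : ℝ)] with t ht0 ht
    have h1 := circleExp_sub_ne_zero zero_le_one le_rfl (abs_le_pi_of_mem_uIoc ht) ht0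
    rw [Complex.ofReal_one] at h1
    have h2 := Circle.coe_ne_zero (Circle.exp t)
    have h3 : (1 : ℂ) - Circle.exp t ≠ 0 := fun h => h1 (by linear_combination -h)
    have h4 : conj (Circle.exp t : ℂ) = (Circle.exp t : ℂ)⁻¹ := by
      rw [← Circle.coe_inv_eq_conj, Circle.coe_inv]
    have h5 : (Circle.exp t : ℂ)⁻¹ - 1 ≠ 0 := fun h => h3 (by
      field_simp at h
      rwa [mul_zero] at h)
    have h6 : conj ((Circle.exp t : ℂ) / ((Circle.exp t : ℂ) - 1)) =
        1 - (Circle.exp t : ℂ) / ((Circle.exp t : ℂ) - 1) := by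
      rw [map_div₀, map_sub, map_one, h4]
      have h7 : (Circle.exp t : ℂ)⁻¹ / ((Circle.exp t : ℂ)⁻¹ - 1) = 1 / (1 - Circle.exp t) := by
        field_simp
      rw [h7]
      field_simp
      ring
    rw [h6]
    ring
  have hper : Function.Periodic w (2 * Real.pi) := hw.1
  have hshift : ∫ t in (-Real.pi)..Real.pi, w (φ + t) = ∫ t in (-Real.pi)..Real.pi, w t := by
    rw [intervalIntegral.integral_comp_add_left]
    have h1 := hper.intervalIntegral_add_eq (φ + -Real.pi) (-Real.pi)
    rwa [show -Real.pi + 2 * Real.pi = Real.pi by ring,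
      show φ + -Real.pi + 2 * Real.pi = φ + Real.pi by ring] at h1
  have hsc : Continuous fun t => w (φ + t) := hwc.comp (continuous_const.add continuous_id)
  have hi' : IntervalIntegrable (fun t => w (φ + t) - w φ) MeasureTheory.volume
      (-Real.pi) Real.pi := (hsc.sub continuous_const).intervalIntegrable _ _
  rw [intervalIntegral.integral_sub hi' hi,
    intervalIntegral.integral_sub (hsc.intervalIntegrable _ _)
      (continuous_const.intervalIntegrable _ _), hshift, intervalIntegral.integral_const] at hκ
  have hc : conj (2 * Real.pi : ℂ)⁻¹ = (2 * Real.pi : ℂ)⁻¹ := by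
    rw [map_inv₀, map_mul, Complex.conj_ofReal, map_ofNat]
  have hpi : (2 * Real.pi : ℂ) ≠ 0 := by simp [Real.pi_ne_zero]
  have hsmul : (Real.pi - -Real.pi) • w φ = 2 * Real.pi * w φ := by
    rw [Complex.real_smul]; push_cast; ring
  rw [regularizedCauchy, regularizedCauchy, map_add, map_mul, hconj, hκ, hc,
    Complex.conj_conj, hsmul]
  field_simp
  ring

/-- The Cauchy integral on the disk, extended by its boundary values. -/
noncomputable def cauchyExtension (w : ℝ → ℂ) (z : ℂ) : ℂ :=
  if ‖z‖ < 1 then cauchyTransform w z else regularizedCauchy w z.arg 1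

theorem cauchyExtension_circleExp_mul {w : ℝ → ℂ} (hp : Function.Periodic w (2 * Real.pi))
    (hw : Continuous w) (φ : ℝ) {r : ℝ} (hr : 0 ≤ r) (hr1 : r ≤ 1) :
    cauchyExtension w (Circle.exp φ * r) = regularizedCauchy w φ r := by
  rcases hr1.lt_or_eq with h | rfl
  · have hr' : ‖(r : ℂ)‖ < 1 := by rwa [Complex.norm_real, Real.norm_of_nonneg hr]
    rw [cauchyExtension, if_pos (by rwa [norm_mul, Circle.norm_coe, one_mul]),
      cauchyTransform_eq_regularizedCauchy hp hw φ hr']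
  · rw [cauchyExtension, if_neg (by simp), Complex.ofReal_one, mul_one]
    exact (regularizedCauchy_periodic hp 1).apply_arg_circleExp φ

theorem cauchyExtension_circleExp {w : ℝ → ℂ} (hp : Function.Periodic w (2 * Real.pi))
    (hw : Continuous w) (φ : ℝ) :
    cauchyExtension w (Circle.exp φ) = regularizedCauchy w φ 1 := by
  simpa using cauchyExtension_circleExp_mul hp hw φ zero_le_one le_rfl

theorem PeriodicHolder.diffContOnCl_cauchyExtension {α : ℝ} (hα : 0 < α) (hα1 : α < 1)
    {w : ℝ → ℂ} (hw : PeriodicHolder α w) :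
    DiffContOnCl ℂ (cauchyExtension w) (Metric.ball (0 : ℂ) 1) := by
  have hwc := hw.continuous hα
  have hd : DifferentiableOn ℂ (cauchyExtension w) (Metric.ball (0 : ℂ) 1) :=
    (differentiableOn_cauchyTransform hw.1 hwc).congr fun z hz => by
      rw [cauchyExtension, if_pos (by simpa using hz)]
  refine ⟨hd, ?_⟩
  rw [closure_ball _ one_ne_zero]
  intro z₀ hz₀
  rw [mem_closedBall_zero_iff] at hz₀
  rcases hz₀.lt_or_eq with h | h
  · exact ((hd z₀ (by simpa using h)).differentiableAt
      (Metric.isOpen_ball.mem_nhds (by simpa using h))).continuousAt.continuousWithinAt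
  have hz₀0 : z₀ ≠ 0 := norm_pos_iff.1 (by rw [h]; exact one_pos)
  set θ := z₀.arg
  have hθ : (Circle.exp θ : ℂ) = z₀ := by
    have := Complex.norm_mul_exp_arg_mul_I z₀
    rwa [h, Complex.ofReal_one, one_mul, ← Circle.coe_exp] at this
  -- Measuring the angle relative to `z₀` keeps the branch cut of `arg` away from the point where
  -- continuity is tested.
  have hrep : ∀ z ∈ Metric.closedBall (0 : ℂ) 1,
      cauchyExtension w z = regularizedCauchy w (θ + (z / z₀).arg) ‖z‖ := by
    intro z hz
    rw [mem_closedBall_zero_iff] at hz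
    rw [← cauchyExtension_circleExp_mul hw.1 hwc _ (norm_nonneg z) hz]
    congr 1
    have := Complex.norm_mul_exp_arg_mul_I (z / z₀)
    rw [norm_div, h, div_one, ← Circle.coe_exp] at this
    rw [Circle.exp_add, Circle.coe_mul, hθ, mul_assoc, mul_comm _ (‖z‖ : ℂ), this]
    field_simp
  refine ContinuousWithinAt.congr ?_ hrep (hrep z₀ (by simp [h]))
  have hg : ContinuousWithinAt (fun z : ℂ => (θ + (z / z₀).arg, ‖z‖))
      (Metric.closedBall (0 : ℂ) 1) z₀ := by
    refine ContinuousAt.continuousWithinAt (ContinuousAt.prodMk ?_ continuous_norm.continuousAt)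
    refine continuousAt_const.add ?_
    refine ContinuousAt.comp (f := fun z => z / z₀) (Complex.continuousAt_arg ?_) (by fun_prop)
    rw [div_self hz₀0]
    exact Complex.one_mem_slitPlane
  refine ContinuousWithinAt.comp (t := Set.univ ×ˢ Set.Icc 0 1)
    (hw.continuousOn_regularizedCauchy hα hα1 _ ?_) hg ?_
  · exact ⟨trivial, norm_nonneg _, hz₀⟩
  · exact fun z hz => ⟨trivial, norm_nonneg _, by simpa using hz⟩

theorem PeriodicHolderDeriv.exists_riesz_decomposition {α : ℝ} (hα : 0 < α) (hα1 : α < 1) {k : ℕ}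
    {φ : Circle → ℂ} (hφ : PeriodicHolderDeriv α k (fun θ => φ (Circle.exp θ))) :
    ∃ p q : ℂ → ℂ,
      (DiffContOnCl ℂ p (Metric.ball (0 : ℂ) 1) ∧
        PeriodicHolderDeriv α k (fun θ => p (Circle.exp θ))) ∧
      (DiffContOnCl ℂ q (Metric.ball (0 : ℂ) 1) ∧
        PeriodicHolderDeriv α k (fun θ => q (Circle.exp θ))) ∧
      ∀ z : Circle, φ z = p z + conj (q z) := by
  set w : ℝ → ℂ := fun θ => φ (Circle.exp θ)
  have hw := hφ.periodicHolder hα hα1.le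
  have hw' := hφ.star.periodicHolder hα hα1.le
  set c : ℂ := (2 * Real.pi : ℂ)⁻¹ * ∫ t in (-Real.pi)..Real.pi, w t
  have e1 := cauchyExtension_circleExp hw.1 (hw.continuous hα)
  have e2 := cauchyExtension_circleExp hw'.1 (hw'.continuous hα)
  -- The mean `c` of `w` occurs in both Cauchy integrals, so it is removed once, from the
  -- antiholomorphic part.
  refine ⟨cauchyExtension w, fun z => cauchyExtension (fun t => conj (w t)) z + (-conj c),
    ⟨hw.diffContOnCl_cauchyExtension hα hα1, ?_⟩,
    ⟨(hw'.diffContOnCl_cauchyExtension hα hα1).add_const _, ?_⟩, fun z => ?_⟩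
  · simp only [e1]
    exact hφ.privalov hα hα1
  · simp only [e2]
    exact (hφ.star.privalov hα hα1).add (PeriodicHolderDeriv.const k _)
  · obtain ⟨θ, rfl⟩ := Circle.exp_surjective z
    have := hw.regularizedCauchy_add_conj hα hα1 θ
    simp only [e1, e2, map_add, map_neg, Complex.conj_conj]
    linear_combination -this

/-! ### The disk algebra and Bezout's identity -/

/-- The dilate `f (r z)` is uniformly close to `f` for `r` near `1`, and its Taylor series converges
uniformly on the closed disk. -/
theorem DiffContOnCl.exists_polynomial_near {f : ℂ → ℂ}
    (hf : DiffContOnCl ℂ f (Metric.ball (0 : ℂ) 1)) {ε : ℝ} (hε : 0 < ε) :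
    ∃ p : Polynomial ℂ, ∀ z ∈ Metric.closedBall (0 : ℂ) 1, ‖p.eval z - f z‖ < ε := by
  have hc := hf.continuousOn_ball
  obtain ⟨δ, hδ, H⟩ := Metric.uniformContinuousOn_iff.1
    ((isCompact_closedBall (0 : ℂ) 1).uniformContinuousOn_of_continuous hc) (ε / 2) (half_pos hε)
  obtain ⟨r, hr1, hr⟩ : ∃ r : ℝ, max 0 (1 - δ) < r ∧ r < 1 :=
    exists_between (max_lt one_pos (by linarith))
  have hr0 : 0 < r := (le_max_left _ _).trans_lt hr1
  have hrδ : 1 - δ < r := (le_max_right _ _).trans_lt hr1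
  obtain ⟨r', hr', hr'1⟩ := exists_between hr
  obtain ⟨R, hR, hR1⟩ := exists_between hr'1
  lift r' to NNReal using (hr0.trans hr').le
  lift R to NNReal using (hr0.trans (hr'.trans hR)).le
  have hps := DifferentiableOn.hasFPowerSeriesOnBall (R := R) (c := 0)
    (hf.differentiableOn.mono (Metric.closedBall_subset_ball hR1))
    (by exact_mod_cast hr0.trans (hr'.trans hR))
  have hu := hps.tendstoUniformlyOn (r' := r') (by exact_mod_cast hR)
  obtain ⟨n, hn⟩ := (Metric.tendstoUniformlyOn_iff.1 hu (ε / 2) (half_pos hε)).exists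
  refine ⟨∑ i ∈ Finset.range n,
    Polynomial.C ((cauchyPowerSeries f 0 R).coeff i * (r : ℂ) ^ i) * Polynomial.X ^ i, ?_⟩
  intro z hz
  have hz1 : ‖z‖ ≤ 1 := by simpa using hz
  have hrz : ‖(r : ℂ) * z‖ ≤ r := by
    rw [norm_mul, Complex.norm_real, Real.norm_of_nonneg hr0.le]
    exact mul_le_of_le_one_right hr0.le hz1
  have h1 := hn (r * z) (by simpa using hrz.trans_lt hr')
  have h2 := H (r * z) (by simpa using hrz.trans hr.le) z hz (by
    have : (r : ℂ) * z - z = ((r - 1 : ℝ) : ℂ) * z := by push_cast; ring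
    rw [dist_eq_norm, this, norm_mul, Complex.norm_real, Real.norm_eq_abs, abs_sub_comm,
      abs_of_nonneg (by linarith)]
    nlinarith [norm_nonneg z])
  have h3 : Polynomial.eval z (∑ i ∈ Finset.range n,
      Polynomial.C ((cauchyPowerSeries f 0 R).coeff i * (r : ℂ) ^ i) * Polynomial.X ^ i) =
      (cauchyPowerSeries f 0 R).partialSum n (r * z) := by
    rw [Polynomial.eval_finsetSum, FormalMultilinearSeries.partialSum]
    refine Finset.sum_congr rfl fun i _ => ?_
    rw [FormalMultilinearSeries.apply_eq_pow_smul_coeff]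
    simp only [Polynomial.eval_mul, Polynomial.eval_C, Polynomial.eval_pow, Polynomial.eval_X,
      smul_eq_mul]
    ring
  rw [h3]
  rw [zero_add] at h1
  rw [dist_comm] at h1
  have := (dist_triangle _ _ _).trans_lt (add_lt_add h1 h2)
  rwa [add_halves, dist_eq_norm] at this

/-- The disk algebra: the uniform closure of the polynomials on the closed unit disk. -/
noncomputable abbrev diskAlgebra : Subalgebra ℂ C(Metric.closedBall (0 : ℂ) 1, ℂ) :=
  (polynomialFunctions (Metric.closedBall (0 : ℂ) 1)).topologicalClosure

theorem DiffContOnCl.exists_diskAlgebra {f : ℂ → ℂ}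
    (hf : DiffContOnCl ℂ f (Metric.ball (0 : ℂ) 1)) :
    ∃ F : diskAlgebra, ∀ z : Metric.closedBall (0 : ℂ) 1, F.1 z = f z := by
  let F : C(Metric.closedBall (0 : ℂ) 1, ℂ) :=
    ⟨fun z => f z, continuousOn_iff_continuous_domRestrict.1 hf.continuousOn_ball⟩
  refine ⟨⟨F, ?_⟩, fun z => rfl⟩
  rw [← SetLike.mem_coe, Subalgebra.topologicalClosure_coe, Metric.mem_closure_iff]
  intro ε hε
  obtain ⟨p, hp⟩ := hf.exists_polynomial_near hε
  refine ⟨p.toContinuousMapOn _, ⟨p, trivial, rfl⟩, ?_⟩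
  rw [ContinuousMap.dist_lt_iff hε]
  intro z
  rw [dist_comm, dist_eq_norm]
  exact hp z z.2

instance : CompleteSpace diskAlgebra :=
  have : IsClosed (diskAlgebra : Set C(Metric.closedBall (0 : ℂ) 1, ℂ)) :=
    Subalgebra.isClosed_topologicalClosure _
  this.completeSpace_coe

instance : NormOneClass diskAlgebra :=
  have : Nonempty (Metric.closedBall (0 : ℂ) 1) := ⟨⟨0, by simp⟩⟩
  ⟨(norm_one : ‖(1 : C(Metric.closedBall (0 : ℂ) 1, ℂ))‖ = 1)⟩

theorem diskAlgebra.norm_character_le (φ : diskAlgebra →ₐ[ℂ] ℂ) (F : diskAlgebra) :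
    ‖φ F‖ ≤ ‖F‖ :=
  AlgHom.norm_apply_le_self φ F

/-- Every character of the disk algebra is the evaluation at a point of the closed disk. -/
theorem diskAlgebra.exists_eval (φ : diskAlgebra →ₐ[ℂ] ℂ) :
    ∃ z : Metric.closedBall (0 : ℂ) 1, ∀ F : diskAlgebra, φ F = F.1 z := by
  have hmem : ∀ p : Polynomial ℂ, p.toContinuousMapOn (Metric.closedBall (0 : ℂ) 1) ∈ diskAlgebra :=
    fun p => Subalgebra.le_topologicalClosure _ ⟨p, trivial, rfl⟩
  let ψ : Polynomial ℂ →ₐ[ℂ] diskAlgebra :=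
    (Polynomial.toContinuousMapOnAlgHom (Metric.closedBall (0 : ℂ) 1)).codRestrict _ hmem
  have hX : ∀ x, (ψ Polynomial.X).1 x = x := fun x => by
    change Polynomial.eval (x : ℂ) Polynomial.X = x
    simp
  have hnorm : ‖φ (ψ Polynomial.X)‖ ≤ 1 := by
    refine (diskAlgebra.norm_character_le φ _).trans ?_
    change ‖(ψ Polynomial.X).1‖ ≤ 1
    rw [ContinuousMap.norm_le _ zero_le_one]
    intro x
    have := x.2
    rw [mem_closedBall_zero_iff] at this
    rwa [hX]
  -- The point is the image of the coordinate function. Agreement there forces agreement on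
  -- polynomials, then everywhere by density, because characters are contractive.
  let z : Metric.closedBall (0 : ℂ) 1 := ⟨φ (ψ Polynomial.X), by simpa using hnorm⟩
  let ev : diskAlgebra →ₐ[ℂ] ℂ :=
    (ContinuousMap.evalAlgHom ℂ ℂ z).comp diskAlgebra.val
  have hpoly : ∀ p, φ (ψ p) = ev (ψ p) := by
    have : φ.comp ψ = ev.comp ψ := by
      ext
      change φ (ψ Polynomial.X) = (ψ Polynomial.X).1 z
      rw [hX]
    exact fun p => DFunLike.congr_fun this p
  refine ⟨z, fun F => ?_⟩
  have hd : ‖φ F - ev F‖ ≤ 0 := by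
    refine le_of_forall_pos_le_add fun ε hε => ?_
    have hF := F.2
    rw [← SetLike.mem_coe, Subalgebra.topologicalClosure_coe, Metric.mem_closure_iff] at hF
    obtain ⟨_, ⟨p, -, rfl⟩, hp⟩ := hF (ε / 2) (half_pos hε)
    have hp' : ‖F - ψ p‖ ≤ ε / 2 := by
      rw [dist_eq_norm] at hp
      exact hp.le
    have e : φ F - ev F = φ (F - ψ p) - ev (F - ψ p) := by
      rw [map_sub, map_sub, hpoly]; ring
    rw [e]
    calc _ ≤ ‖F - ψ p‖ + ‖F - ψ p‖ := (norm_sub_le _ _).trans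
          (add_le_add (diskAlgebra.norm_character_le φ _) (diskAlgebra.norm_character_le ev _))
      _ ≤ 0 + ε := by linarith
  exact sub_eq_zero.1 (norm_le_zero_iff.1 hd)

/-- A proper ideal containing `a` and `b` would lie in a maximal ideal, the kernel of a character by
Gelfand–Mazur, hence of an evaluation at a common zero. -/
theorem diskAlgebra.exists_bezout (a b : diskAlgebra)
    (h : ∀ z, ¬ (a.1 z = 0 ∧ b.1 z = 0)) : ∃ u v : diskAlgebra, u * a + v * b = 1 := by
  rw [← Ideal.mem_span_pair, ← Ideal.eq_top_iff_one]
  by_contra hne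
  obtain ⟨I, hI, hle⟩ := Ideal.exists_le_maximal _ hne
  obtain ⟨z, hz⟩ := diskAlgebra.exists_eval
    (WeakDual.CharacterSpace.toAlgHom I.toCharacterSpace)
  refine h z ⟨?_, ?_⟩
  · rw [← hz]
    exact I.toCharacterSpace_apply_eq_zero_of_mem (hle (Ideal.subset_span (by simp)))
  · rw [← hz]
    exact I.toCharacterSpace_apply_eq_zero_of_mem (hle (Ideal.subset_span (by simp)))

theorem diskAlgebra.exists_polynomial_near (F : diskAlgebra) {ε : ℝ} (hε : 0 < ε) :
    ∃ p : Polynomial ℂ, ∀ z : Metric.closedBall (0 : ℂ) 1, ‖p.eval (z : ℂ) - F.1 z‖ < ε := by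
  have hF := F.2
  rw [← SetLike.mem_coe, Subalgebra.topologicalClosure_coe, Metric.mem_closure_iff] at hF
  obtain ⟨_, ⟨p, -, rfl⟩, hp⟩ := hF ε hε
  rw [dist_comm, ContinuousMap.dist_lt_iff hε] at hp
  refine ⟨p, fun z => ?_⟩
  rw [← dist_eq_norm]
  exact hp z

/-- Bezout coefficients from the disk algebra are merely continuous on the circle. Polynomial
approximations are smooth there, and with an error below `1` in the identity the combination still
has no zero; dividing by it restores `1` within `C^s`. -/
theorem exists_polynomial_bezout {a b : ℂ → ℂ} (ha : DiffContOnCl ℂ a (Metric.ball (0 : ℂ) 1))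
    (hb : DiffContOnCl ℂ b (Metric.ball (0 : ℂ) 1))
    (h : ∀ z ∈ Metric.closedBall (0 : ℂ) 1, ¬ (a z = 0 ∧ b z = 0)) :
    ∃ u v : Polynomial ℂ, ∀ z ∈ Metric.closedBall (0 : ℂ) 1,
      a z * u.eval z + b z * v.eval z ≠ 0 := by
  obtain ⟨A, hA⟩ := ha.exists_diskAlgebra
  obtain ⟨B, hB⟩ := hb.exists_diskAlgebra
  obtain ⟨U, V, hUV⟩ := diskAlgebra.exists_bezout A B (fun z => by
    rw [hA, hB]; exact h z z.2)
  have hε : 0 < 1 / (‖A‖ + ‖B‖ + 1) := by positivity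
  obtain ⟨u, hu⟩ := diskAlgebra.exists_polynomial_near U hε
  obtain ⟨v, hv⟩ := diskAlgebra.exists_polynomial_near V hε
  refine ⟨u, v, fun z hz h0 => ?_⟩
  have e : U.1 ⟨z, hz⟩ * a z + V.1 ⟨z, hz⟩ * b z = 1 := by
    have := congrArg (fun F : diskAlgebra => F.1 ⟨z, hz⟩) hUV
    simpa [hA, hB] using this
  have hAz : ‖a z‖ ≤ ‖A‖ := by
    rw [← hA ⟨z, hz⟩]; exact ContinuousMap.norm_coe_le_norm A.1 _
  have hBz : ‖b z‖ ≤ ‖B‖ := by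
    rw [← hB ⟨z, hz⟩]; exact ContinuousMap.norm_coe_le_norm B.1 _
  have e2 : (1 : ℂ) =
      -(a z * (u.eval z - U.1 ⟨z, hz⟩) + b z * (v.eval z - V.1 ⟨z, hz⟩)) := by
    linear_combination -e + h0
  have : (1 : ℝ) ≤ ‖A‖ * (1 / (‖A‖ + ‖B‖ + 1)) + ‖B‖ * (1 / (‖A‖ + ‖B‖ + 1)) := by
    calc (1 : ℝ) = ‖(1 : ℂ)‖ := norm_one.symm
      _ = ‖a z * (u.eval z - U.1 ⟨z, hz⟩) + b z * (v.eval z - V.1 ⟨z, hz⟩)‖ := by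
          exact (congrArg norm e2).trans (norm_neg _)
      _ ≤ ‖a z‖ * ‖u.eval z - U.1 ⟨z, hz⟩‖ + ‖b z‖ * ‖v.eval z - V.1 ⟨z, hz⟩‖ := by
          rw [← norm_mul, ← norm_mul]; exact norm_add_le _ _
      _ ≤ _ := by
          gcongr
          · exact (hu ⟨z, hz⟩).le
          · exact (hv ⟨z, hz⟩).le
  rw [← add_mul, mul_one_div, le_div_iff₀ (by positivity)] at this
  linarith

/-! ### Algebra of `C^s` functions on the circle and the disk -/

section CsAlgebra

variable {s : ℝ}

namespace IsCsOnCircle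

variable {φ ψ : Circle → ℂ}

theorem const (hs : 0 < s - (⌊s⌋₊ : ℝ)) (c : ℂ) : IsCsOnCircle s (fun _ => c) :=
  (isCsOnCircle_iff hs _).2 (PeriodicHolderDeriv.const _ c)

theorem add (hs : 0 < s - (⌊s⌋₊ : ℝ)) (hφ : IsCsOnCircle s φ) (hψ : IsCsOnCircle s ψ) :
    IsCsOnCircle s (fun z => φ z + ψ z) :=
  (isCsOnCircle_iff hs _).2
    (((isCsOnCircle_iff hs _).1 hφ).add ((isCsOnCircle_iff hs _).1 hψ))

theorem mul (hs : 0 < s - (⌊s⌋₊ : ℝ)) (hs1 : s - (⌊s⌋₊ : ℝ) < 1) (hφ : IsCsOnCircle s φ)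
    (hψ : IsCsOnCircle s ψ) : IsCsOnCircle s (fun z => φ z * ψ z) :=
  (isCsOnCircle_iff hs _).2
    (((isCsOnCircle_iff hs _).1 hφ).mul hs hs1.le ((isCsOnCircle_iff hs _).1 hψ))

theorem inv (hs : 0 < s - (⌊s⌋₊ : ℝ)) (hs1 : s - (⌊s⌋₊ : ℝ) < 1) (hφ : IsCsOnCircle s φ)
    (h0 : ∀ z, φ z ≠ 0) : IsCsOnCircle s (fun z => (φ z)⁻¹) :=
  (isCsOnCircle_iff hs _).2 (((isCsOnCircle_iff hs _).1 hφ).inv hs hs1.le fun _ => h0 _)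

theorem star (hs : 0 < s - (⌊s⌋₊ : ℝ)) (hφ : IsCsOnCircle s φ) :
    IsCsOnCircle s (fun z => conj (φ z)) :=
  (isCsOnCircle_iff hs _).2 ((isCsOnCircle_iff hs _).1 hφ).star

theorem const_mul (hs : 0 < s - (⌊s⌋₊ : ℝ)) (hs1 : s - (⌊s⌋₊ : ℝ) < 1) (c : ℂ)
    (hφ : IsCsOnCircle s φ) : IsCsOnCircle s (fun z => c * φ z) :=
  (const hs c).mul hs hs1 hφ

theorem exists_riesz_decomposition (hs : 0 < s - (⌊s⌋₊ : ℝ)) (hs1 : s - (⌊s⌋₊ : ℝ) < 1)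
    (hφ : IsCsOnCircle s φ) : ∃ p q : ℂ → ℂ, HolomorphicCs s p ∧ HolomorphicCs s q ∧
      ∀ z : Circle, φ z = p z + conj (q z) := by
  obtain ⟨p, q, ⟨hp, hp'⟩, ⟨hq, hq'⟩, h⟩ :=
    ((isCsOnCircle_iff hs _).1 hφ).exists_riesz_decomposition hs hs1
  exact ⟨p, q, ⟨hp, (isCsOnCircle_iff hs _).2 hp'⟩, ⟨hq, (isCsOnCircle_iff hs _).2 hq'⟩, h⟩

end IsCsOnCircle

namespace HolomorphicCs

variable {f g : ℂ → ℂ}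

theorem const (hs : 0 < s - (⌊s⌋₊ : ℝ)) (c : ℂ) : HolomorphicCs s (fun _ => c) :=
  ⟨diffContOnCl_const, IsCsOnCircle.const hs c⟩

theorem add (hs : 0 < s - (⌊s⌋₊ : ℝ)) (hf : HolomorphicCs s f) (hg : HolomorphicCs s g) :
    HolomorphicCs s (fun z => f z + g z) :=
  ⟨hf.1.add hg.1, hf.2.add hs hg.2⟩

theorem mul (hs : 0 < s - (⌊s⌋₊ : ℝ)) (hs1 : s - (⌊s⌋₊ : ℝ) < 1) (hf : HolomorphicCs s f)
    (hg : HolomorphicCs s g) : HolomorphicCs s (fun z => f z * g z) :=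
  ⟨hf.1.smul hg.1, hf.2.mul hs hs1 hg.2⟩

theorem const_mul (hs : 0 < s - (⌊s⌋₊ : ℝ)) (hs1 : s - (⌊s⌋₊ : ℝ) < 1) (c : ℂ)
    (hf : HolomorphicCs s f) : HolomorphicCs s (fun z => c * f z) :=
  (const hs c).mul hs hs1 hf

theorem neg (hs : 0 < s - (⌊s⌋₊ : ℝ)) (hs1 : s - (⌊s⌋₊ : ℝ) < 1) (hf : HolomorphicCs s f) :
    HolomorphicCs s (fun z => -f z) := by
  simpa using hf.const_mul hs hs1 (-1)

theorem inv (hs : 0 < s - (⌊s⌋₊ : ℝ)) (hs1 : s - (⌊s⌋₊ : ℝ) < 1) (hf : HolomorphicCs s f)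
    (h0 : ∀ z ∈ Metric.closedBall (0 : ℂ) 1, f z ≠ 0) : HolomorphicCs s (fun z => (f z)⁻¹) :=
  ⟨hf.1.inv fun z hz => h0 z (by rwa [closure_ball _ one_ne_zero] at hz),
    hf.2.inv hs hs1 fun z => h0 z (mem_closedBall_zero_iff.2 z.norm_coe.le)⟩

theorem id (hs : 0 < s - (⌊s⌋₊ : ℝ)) (hs1 : s - (⌊s⌋₊ : ℝ) < 1) :
    HolomorphicCs s (fun z => z) :=
  ⟨differentiable_id.diffContOnCl,
    (isCsOnCircle_iff hs _).2 (periodicHolderDeriv_exp hs hs1.le _)⟩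

theorem polynomial (hs : 0 < s - (⌊s⌋₊ : ℝ)) (hs1 : s - (⌊s⌋₊ : ℝ) < 1) (p : Polynomial ℂ) :
    HolomorphicCs s (fun z => p.eval z) := by
  induction p using Polynomial.induction_on with
  | C c => simpa using const hs c
  | add p q hp hq => simpa using hp.add hs hq
  | monomial n c h =>
    refine Eq.mp (congrArg _ (funext fun z => ?_)) (h.mul hs hs1 (HolomorphicCs.id hs hs1))
    simp [pow_succ, mul_assoc]

end HolomorphicCs

end CsAlgebra

/-! ### Completing a row and triangular factorization -/

/-- A row `(p, q)` on the circle which completes a row `(a, b)` of holomorphic functions without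
common zeros to a matrix of determinant one is, modulo an antiholomorphic multiple of `(a, b)`,
a row of holomorphic functions. -/
theorem exists_holomorphic_completion {s : ℝ} (hs : 0 < s - (⌊s⌋₊ : ℝ))
    (hs1 : s - (⌊s⌋₊ : ℝ) < 1) {a b : ℂ → ℂ} (ha : HolomorphicCs s a) (hb : HolomorphicCs s b)
    (hab : NoCommonZero a b) {p q : Circle → ℂ} (hp : IsCsOnCircle s p) (hq : IsCsOnCircle s q)
    (hdet : ∀ z : Circle, a z * q z - b z * p z = 1) :
    ∃ y u v : ℂ → ℂ, HolomorphicCs s y ∧ HolomorphicCs s u ∧ HolomorphicCs s v ∧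
      (∀ z ∈ Metric.ball (0 : ℂ) 1, a z * v z - b z * u z = 1) ∧
      ∀ z : Circle, p z = conj (y z) * a z + u z ∧ q z = conj (y z) * b z + v z := by
  obtain ⟨U, V, hUV⟩ := exists_polynomial_bezout ha.1 hb.1 fun z hz => by
    rw [mem_closedBall_zero_iff] at hz
    rcases hz.lt_or_eq with h | h
    · exact hab z (by simpa using h)
    · rintro ⟨h1, h2⟩
      have := hdet ⟨z, mem_sphere_zero_iff_norm.2 h⟩
      simp [h1, h2] at this
  have hei := (((ha.mul hs hs1 (.polynomial hs hs1 U)).add hs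
    (hb.mul hs hs1 (.polynomial hs hs1 V))).inv hs hs1 hUV)
  have hv := (HolomorphicCs.polynomial hs hs1 U).mul hs hs1 hei
  have hu := ((HolomorphicCs.polynomial hs hs1 V).mul hs hs1 hei).neg hs hs1
  set v : ℂ → ℂ := fun z => U.eval z * (a z * U.eval z + b z * V.eval z)⁻¹ with hvdef
  set u : ℂ → ℂ := fun z => -(V.eval z * (a z * U.eval z + b z * V.eval z)⁻¹) with hudef
  have huv : ∀ z ∈ Metric.closedBall (0 : ℂ) 1, a z * v z - b z * u z = 1 := by
    intro z hz
    have := mul_inv_cancel₀ (hUV z hz)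
    simp only [hvdef, hudef]
    linear_combination this
  -- The multiplier is `w = p v - q u`: the two determinant equations give `(p, q) - (u, v) = w (a,
  -- b)`. Its part `P` joins `(u, v)`, and `conj Q` remains.
  obtain ⟨P, Q, hP, hQ, hw⟩ := ((hp.mul hs hs1 hv.2).add hs
    ((hq.mul hs hs1 hu.2).const_mul hs hs1 (-1))).exists_riesz_decomposition hs hs1
  refine ⟨Q, fun z => P z * a z + u z, fun z => P z * b z + v z, hQ,
    (hP.mul hs hs1 ha).add hs hu, (hP.mul hs hs1 hb).add hs hv, fun z hz => ?_, fun z => ⟨?_, ?_⟩⟩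
  · linear_combination huv z (Metric.ball_subset_closedBall hz)
  · linear_combination a z * hw z + u z * hdet z - p z * huv z (mem_closedBall_zero_iff.2 z.norm_coe.le)
  · linear_combination b z * hw z + v z * hdet z - q z * huv z (mem_closedBall_zero_iff.2 z.norm_coe.le)

theorem hasLowerFactorization_of_rows {s : ℝ} (hs : 0 < s - (⌊s⌋₊ : ℝ))
    (hs1 : s - (⌊s⌋₊ : ℝ) < 1) {a b : ℂ → ℂ} (ha : HolomorphicCs s a) (hb : HolomorphicCs s b)
    (hab : NoCommonZero a b) (ha0 : a 0 ≠ 0) {p q : Circle → ℂ} (hp : IsCsOnCircle s p)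
    (hq : IsCsOnCircle s q) (hdet : ∀ z : Circle, a z * q z - b z * p z = 1)
    {G : Circle → Matrix (Fin 2) (Fin 2) ℂ} (hG : ∀ z : Circle, G z = !![a z, b z; p z, q z]) :
    HasLowerFactorization s G (a 0) := by
  obtain ⟨y, u, v, hy, hu, hv, huv, hpq⟩ :=
    exists_holomorphic_completion hs hs1 ha hb hab hp hq hdet
  set t := a 0 with ht
  -- Shifting `k` times the top row between the factors makes `γ 0 = 0`; then `δ 0 = 1` follows from
  -- the determinant.
  set k := -u 0 / t with hk
  have hdet1 : ∀ z ∈ Metric.ball (0 : ℂ) 1,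
      t⁻¹ * a z * (t * (v z + k * b z)) - t⁻¹ * b z * (t * (u z + k * a z)) = 1 := by
    intro z hz
    have h1 := mul_inv_cancel₀ ha0
    linear_combination huv z hz + (a z * v z - b z * u z) * h1
  have hα0 : t⁻¹ * a 0 = 1 := inv_mul_cancel₀ ha0
  have hγ0 : t * (u 0 + k * a 0) = 0 := by
    rw [hk, ← ht]
    field_simp
    ring
  refine ⟨fun z => y z + (-conj k), fun z => t⁻¹ * a z, fun z => t⁻¹ * b z,
    fun z => t * (u z + k * a z), fun z => t * (v z + k * b z),
    hy.add hs (.const hs _), ⟨ha.const_mul hs hs1 _, hb.const_mul hs hs1 _,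
      (hu.add hs (ha.const_mul hs hs1 k)).const_mul hs hs1 _,
      (hv.add hs (hb.const_mul hs hs1 k)).const_mul hs hs1 _,
      fun z hz => ?_, hα0, hγ0, ?_⟩, fun z => ?_⟩
  · rw [Matrix.det_fin_two_of]
    exact hdet1 z hz
  · have := hdet1 0 (by simp)
    rwa [hγ0, hα0, mul_zero, sub_zero, one_mul] at this
  · rw [hG, reflect_circle]
    obtain ⟨h1, h2⟩ := hpq z
    ext i j
    fin_cases i <;> fin_cases j <;>
      simp [Matrix.mul_apply, Fin.sum_univ_two, h1, h2, mul_inv_cancel_left₀ ha0,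
        inv_mul_cancel_left₀ ha0]
    · field_simp
      ring
    · field_simp
      ring

theorem hasUpperFactorization_of_rows {s : ℝ} (hs : 0 < s - (⌊s⌋₊ : ℝ))
    (hs1 : s - (⌊s⌋₊ : ℝ) < 1) {c d : ℂ → ℂ} (hc : HolomorphicCs s c) (hd : HolomorphicCs s d)
    (hcd : NoCommonZero c d) (hc0 : c 0 = 0) (hd0 : d 0 ≠ 0) {p q : Circle → ℂ}
    (hp : IsCsOnCircle s p) (hq : IsCsOnCircle s q)
    (hdet : ∀ z : Circle, p z * d z - q z * c z = 1)
    {G : Circle → Matrix (Fin 2) (Fin 2) ℂ} (hG : ∀ z : Circle, G z = !![p z, q z; c z, d z]) :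
    HasUpperFactorization s G (d 0)⁻¹ := by
  obtain ⟨y, u, v, hy, hu, hv, huv, hpq⟩ :=
    exists_holomorphic_completion hs hs1 hc hd hcd (hp.const_mul hs hs1 (-1))
      (hq.const_mul hs hs1 (-1)) (fun z => by linear_combination hdet z)
  set τ := d 0 with hτ
  -- Here `γ 0 = 0` is automatic from `c 0 = 0`. The free constant instead moves the value of `x^*`
  -- at infinity into the right factor, where the upper right entry at `0` is unconstrained.
  set k := conj (y 0)
  have hdet1 : ∀ z ∈ Metric.ball (0 : ℂ) 1,
      τ * (-1 * (u z + k * c z)) * (τ⁻¹ * d z) - τ * (-1 * (v z + k * d z)) * (τ⁻¹ * c z) = 1 := by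
    intro z hz
    have h1 := mul_inv_cancel₀ hd0
    linear_combination huv z hz + (c z * v z - d z * u z) * h1
  have hδ0 : τ⁻¹ * d 0 = 1 := inv_mul_cancel₀ hd0
  have hγ0 : τ⁻¹ * c 0 = 0 := by rw [hc0, mul_zero]
  refine ⟨fun z => -1 * y z + y 0, fun z => τ * (-1 * (u z + k * c z)),
    fun z => τ * (-1 * (v z + k * d z)), fun z => τ⁻¹ * c z, fun z => τ⁻¹ * d z,
    (hy.const_mul hs hs1 _).add hs (.const hs _), ?_,
    ⟨((hu.add hs (hc.const_mul hs hs1 k)).const_mul hs hs1 _).const_mul hs hs1 _,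
      ((hv.add hs (hd.const_mul hs hs1 k)).const_mul hs hs1 _).const_mul hs hs1 _,
      hc.const_mul hs hs1 _, hd.const_mul hs hs1 _, fun z hz => ?_, ?_, hγ0, hδ0⟩, fun z => ?_⟩
  · rw [reflect_infty]
    simp
  · rw [Matrix.det_fin_two_of]
    exact hdet1 z hz
  · have := hdet1 0 (by simp)
    rwa [hγ0, hδ0, mul_zero, sub_zero, mul_one] at this
  · rw [hG, reflect_circle]
    obtain ⟨h1, h2⟩ := hpq z
    ext i j
    fin_cases i <;> fin_cases j <;>
      simp [Matrix.mul_apply, Fin.sum_univ_two, mul_inv_cancel_left₀ hd0,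
        inv_mul_cancel_left₀ hd0]
    · field_simp
      linear_combination -h1
    · field_simp
      linear_combination -h2

/-! ### The equivalences -/

theorem invStar_apply (g : Circle → Matrix.SpecialLinearGroup (Fin 2) ℂ) (z : Circle) :
    invStar g z = !![conj ((g z).1 1 1), -conj ((g z).1 1 0);
      -conj ((g z).1 0 1), conj ((g z).1 0 0)] := by
  rw [invStar, Matrix.SpecialLinearGroup.coe_inv, Matrix.adjugate_fin_two]
  ext i j
  fin_cases i <;> fin_cases j <;> simp [Matrix.conjTranspose_apply]

/-- The row lemma applies to `(a, b)` for `g` and to `(d, -c)` for `g^{-*}`. The diagonal constants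
are `a 0` and `d 0`, conjugate by the normalization of the form. -/
theorem MatrixFormOne.triangularOne {s : ℝ} (hs : 0 < s - (⌊s⌋₊ : ℝ))
    (hs1 : s - (⌊s⌋₊ : ℝ) < 1) {g : Circle → Matrix.SpecialLinearGroup (Fin 2) ℂ}
    (h : MatrixFormOne s g) : TriangularOne s g := by
  obtain ⟨a, b, c, d, ha, hb, hc, hd, hg, h0, ha0, hab, hcd⟩ := h
  rw [reflect_infty] at h0
  simp only [reflect_circle] at hg
  have hdet : ∀ z : Circle, a z * conj (d z) - b z * conj (c z) = 1 := fun z => by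
    have := (g z).2
    rwa [hg, Matrix.det_fin_two_of] at this
  have hd0 : d 0 = conj (a 0) := by rw [h0, Complex.conj_conj]
  refine ⟨a 0, ha0, hasLowerFactorization_of_rows hs hs1 ha hb hab ha0 (hc.2.star hs)
    (hd.2.star hs) hdet hg, ?_⟩
  rw [← hd0]
  refine hasLowerFactorization_of_rows hs hs1 hd (hc.neg hs hs1)
    (fun z hz h => hcd z hz ⟨neg_eq_zero.1 h.2, h.1⟩) ?_
    (p := fun z => -1 * conj (b z)) (q := fun z => conj (a z))
    ((hb.2.star hs).const_mul hs hs1 _) (ha.2.star hs) (fun z => ?_) (fun z => ?_)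
  · rw [hd0]
    exact (map_ne_zero _).2 ha0
  · have := congrArg conj (hdet z)
    simp only [map_sub, map_mul, Complex.conj_conj, map_one] at this
    linear_combination this
  · rw [invStar_apply, hg]
    simp

theorem MatrixFormTwo.triangularTwo {s : ℝ} (hs : 0 < s - (⌊s⌋₊ : ℝ))
    (hs1 : s - (⌊s⌋₊ : ℝ) < 1) {g : Circle → Matrix.SpecialLinearGroup (Fin 2) ℂ}
    (h : MatrixFormTwo s g) : TriangularTwo s g := by
  obtain ⟨a, b, c, d, ha, hb, hc, hd, hg, hb0, hc0, h0, hd0, hab, hcd⟩ := h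
  rw [reflect_infty] at h0
  simp only [reflect_circle] at hg
  have hdet : ∀ z : Circle, conj (a z) * d z - conj (b z) * c z = 1 := fun z => by
    have := (g z).2
    rwa [hg, Matrix.det_fin_two_of] at this
  have ha0 : a 0 = conj (d 0) := by rw [← h0, Complex.conj_conj]
  refine ⟨(d 0)⁻¹, inv_ne_zero hd0, hasUpperFactorization_of_rows hs hs1 hc hd hcd hc0 hd0
    (ha.2.star hs) (hb.2.star hs) hdet hg, ?_⟩
  rw [map_inv₀, ← ha0]
  refine hasUpperFactorization_of_rows hs hs1 (hb.neg hs hs1) ha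
    (fun z hz h => hab z hz ⟨h.2, neg_eq_zero.1 h.1⟩) (by simp [hb0]) ?_
    (p := fun z => conj (d z)) (q := fun z => -1 * conj (c z))
    (hd.2.star hs) ((hc.2.star hs).const_mul hs hs1 _) (fun z => ?_) (fun z => ?_)
  · rw [ha0]
    exact (map_ne_zero _).2 hd0
  · have := congrArg conj (hdet z)
    simp only [map_sub, map_mul, Complex.conj_conj, map_one] at this
    linear_combination this
  · rw [invStar_apply, hg]
    simp

theorem TriangularOne.matrixFormOne {s : ℝ} (hs : 0 < s - (⌊s⌋₊ : ℝ))
    (hs1 : s - (⌊s⌋₊ : ℝ) < 1) {g : Circle → Matrix.SpecialLinearGroup (Fin 2) ℂ}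
    (h : TriangularOne s g) : MatrixFormOne s g := by
  obtain ⟨t, ht, ⟨y, α, β, γ, δ, -, ⟨hα, hβ, -, -, hdet, hα0, -, -⟩, hg⟩,
    ⟨y', α', β', γ', δ', -, ⟨hα', hβ', -, -, hdet', hα0', -, -⟩, hg'⟩⟩ := h
  have ht' : conj t ≠ 0 := (map_ne_zero _).2 ht
  simp only [Matrix.det_fin_two_of] at hdet hdet'
  refine ⟨fun z => t * α z, fun z => t * β z, fun z => -conj t * β' z, fun z => conj t * α' z,
    hα.const_mul hs hs1 _, hβ.const_mul hs hs1 _, hβ'.const_mul hs hs1 _, hα'.const_mul hs hs1 _,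
    fun z => ?_, ?_, ?_, fun z hz hz0 => ?_, fun z hz hz0 => ?_⟩
  · have h1 := hg z
    have h2 := hg' z
    rw [invStar_apply] at h2
    have e1 := congrFun (congrFun h2 0) 0
    have e2 := congrFun (congrFun h2 0) 1
    simp [Matrix.mul_apply, Fin.sum_univ_two] at e1 e2
    have e1' := congrArg conj e1
    have e2' := congrArg conj e2
    simp only [map_neg, map_mul, Complex.conj_conj] at e1' e2'
    have f1 := congrFun (congrFun h1 0) 0
    have f2 := congrFun (congrFun h1 0) 1
    simp [Matrix.mul_apply, Fin.sum_univ_two] at f1 f2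
    simp only [reflect_circle]
    ext i j
    fin_cases i <;> fin_cases j
    · simpa using f1
    · simpa using f2
    · simp
      linear_combination -e2'
    · simpa using e1'
  · simp [reflect_infty, hα0, hα0']
  · simpa [hα0] using ht
  · have h1 : α z = 0 := (mul_eq_zero.1 hz0.1).resolve_left ht
    have h2 : β z = 0 := (mul_eq_zero.1 hz0.2).resolve_left ht
    have := hdet z hz
    simp [h1, h2] at this
  · have h1 : β' z = 0 := (mul_eq_zero.1 hz0.1).resolve_left (neg_ne_zero.2 ht')
    have h2 : α' z = 0 := (mul_eq_zero.1 hz0.2).resolve_left ht'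
    have := hdet' z hz
    simp [h1, h2] at this

/-- An upper unipotent left factor preserves bottom rows: that of `g` is `t⁻¹ (γ, δ)`, and that of
`g^{-*}` is `(-b, a)`, which determines the top row of `g`. -/
theorem TriangularTwo.matrixFormTwo {s : ℝ} (hs : 0 < s - (⌊s⌋₊ : ℝ))
    (hs1 : s - (⌊s⌋₊ : ℝ) < 1) {g : Circle → Matrix.SpecialLinearGroup (Fin 2) ℂ}
    (h : TriangularTwo s g) : MatrixFormTwo s g := by
  obtain ⟨t, ht, ⟨x, α, β, γ, δ, -, -, ⟨-, -, hγ, hδ, hdet, -, hγ0, hδ0⟩, hg⟩,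
    ⟨x', α', β', γ', δ', -, -, ⟨-, -, hγ', hδ', hdet', -, hγ0', hδ0'⟩, hg'⟩⟩ := h
  have ht' : (conj t)⁻¹ ≠ 0 := inv_ne_zero ((map_ne_zero _).2 ht)
  have hti : t⁻¹ ≠ 0 := inv_ne_zero ht
  simp only [Matrix.det_fin_two_of] at hdet hdet'
  refine ⟨fun z => (conj t)⁻¹ * δ' z, fun z => -(conj t)⁻¹ * γ' z, fun z => t⁻¹ * γ z,
    fun z => t⁻¹ * δ z, hδ'.const_mul hs hs1 _, hγ'.const_mul hs hs1 _, hγ.const_mul hs hs1 _,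
    hδ.const_mul hs hs1 _, fun z => ?_, by simp [hγ0'], by simp [hγ0], ?_, ?_,
    fun z hz hz0 => ?_, fun z hz hz0 => ?_⟩
  · have h1 := hg z
    have h2 := hg' z
    rw [invStar_apply] at h2
    have e1 := congrFun (congrFun h2 1) 0
    have e2 := congrFun (congrFun h2 1) 1
    simp [Matrix.mul_apply, Fin.sum_univ_two] at e1 e2
    have e1' := congrArg conj e1
    have e2' := congrArg conj e2
    simp only [map_neg, map_mul, map_inv₀, Complex.conj_conj] at e1' e2'
    have f1 := congrFun (congrFun h1 1) 0
    have f2 := congrFun (congrFun h1 1) 1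
    simp [Matrix.mul_apply, Fin.sum_univ_two] at f1 f2
    simp only [reflect_circle]
    ext i j
    fin_cases i <;> fin_cases j
    · simpa using e2'
    · simp
      linear_combination -e1'
    · simpa using f1
    · simpa using f2
  · simp [reflect_infty, hδ0, hδ0']
  · simpa [hδ0] using ht
  · have h1 : δ' z = 0 := (mul_eq_zero.1 hz0.1).resolve_left ht'
    have h2 : γ' z = 0 := (mul_eq_zero.1 hz0.2).resolve_left (neg_ne_zero.2 ht')
    have := hdet' z hz
    simp [h1, h2] at this
  · have h1 : γ z = 0 := (mul_eq_zero.1 hz0.1).resolve_left hti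
    have h2 : δ z = 0 := (mul_eq_zero.1 hz0.2).resolve_left hti
    have := hdet z hz
    simp [h1, h2] at this

theorem theorem2p1 (s : ℝ) (hs : 0 < s) (hs_nonint : ∀ n : ℤ, s ≠ (n : ℝ)) :
    (∀ g₁ : Circle → Matrix.SpecialLinearGroup (Fin 2) ℂ, IsCsLoop s g₁ →
      (MatrixFormOne s g₁ ↔ TriangularOne s g₁)) ∧
    (∀ g₂ : Circle → Matrix.SpecialLinearGroup (Fin 2) ℂ, IsCsLoop s g₂ →
      (MatrixFormTwo s g₂ ↔ TriangularTwo s g₂)) := by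
  have h0 : 0 < s - (⌊s⌋₊ : ℝ) := by
    refine sub_pos.2 (lt_of_le_of_ne (Nat.floor_le hs.le) fun h => hs_nonint ⌊s⌋₊ ?_)
    rw [Int.cast_natCast]
    exact h.symm
  have h1 : s - (⌊s⌋₊ : ℝ) < 1 := by linarith [Nat.lt_floor_add_one s]
  exact ⟨fun g _ => ⟨fun h => h.triangularOne h0 h1, fun h => h.matrixFormOne h0 h1⟩,
    fun g _ => ⟨fun h => h.triangularTwo h0 h1, fun h => h.matrixFormTwo h0 h1⟩⟩
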